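/- **Propositional dependence logic (PDL).** Let $\mathrm{VAR}$ be a countably infinite set of variables, taken to be the finite words over $\{0,1\}$. Formulas are given by $$\varphi ::= \top \mid \bot \mid x \mid \neg x \mid \varphi\lor\varphi \mid \varphi\land\varphi \mid \mathrm{dep}(X;Y) \mid \neg\,\mathrm{dep}(X;Y),$$ where $x\in\mathrm{VAR}$ and $X,Y\subset\mathrm{VAR}$ are finite. A team is a set $T$ of assignments $t:\mathrm{VAR}\to\{0,1\}$, and $T\models\varphi$ is defined as follows. - $T\models\top$ always. - $T\models x$ (resp. $T\models\neg x$) iff $t(x)=1$ (resp. $t(x)=0$) for all $t\in T$. - $T\models\varphi\land\psi$ iff $T\models\varphi$ and $T\models\psi$. - $T\models\varphi\lor\psi$ iff there are $T_1,T_2$ with $T_1\cup T_2=T$, $T_1\models\varphi$ and $T_2\models\psi$. - $T\models\mathrm{dep}(X;Y)$ iff any $t,t'\in T$ that agree on $X$ agree on $Y$. - $T\models\neg\,\mathrm{dep}(X;Y)$ iff $T=\emptyset$. - $T\models\bot$ never. (The theorem holds equally under the convention that $T\models\bot$ iff $T=\emptyset$.) A formula $\Phi$ is *satisfiable* if $T\models\Phi$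 for some nonempty team $T$, and $\mathrm{splits}(\Phi)$ is the number of occurrences of $\lor$ in $\Phi$. Formulas are written in prefix notation as words over a fixed finite alphabet $\Sigma$. A variable is written as its name with an end marker, and a finite set of variables as a list of its members. Write $|\Phi|$ for the length of the word that represents $\Phi$. Algorithms are deterministic Turing machines with finitely many stacks (equivalently, tapes), and time is the number of steps. A parameterised problem $\Pi\subseteq\Sigma^*\times\mathbb{N}$ is *fixed-parameter tractable* (in FPT) if there are an algorithm, a computable function $f$ and a polynomial $p$ such that, for every $(x,k)\in\Sigma^*\times\mathbb{N}$, the algorithm decides whether $(x,k)\in\Pi$ in time at most $f(k)\cdot p(|x|)$. **Theorem.** The satisfiability problem of PDL parameterised by the number of split-junctions, that is, the set of all pairs $(x,\mathrm{splits}(\Phi))$ where the word $x$ represents a satisfiable formula $\Phi$, is in FPT. Moreover, there is an algorithm that, given any PDL formula $\Phi$, decides whether $\Phi$ is satisfiable in time $O\bigl(2^{\mathrm{splits}(\Phi)}\cdot|\Phi|^{O(1)}\bigr)$; that is, there are constants $C,d$ such that it makes at most $C\cdot 2^{\mathrm{splits}(\Phi)}\cdot|\Phi|^{d}$ steps on every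 $\Phi$. -/

import Mathlib

namespace PDL

/-- The countably infinite set of propositional variables: a variable is its name, a finite word
over `{0, 1}`. -/
abbrev Var : Type := List Bool

/-- Formulas of propositional dependence logic, given as syntax trees. -/
inductive Formula : Type
  | top : Formula
  | bot : Formula
  | pos (v : Var) : Formula
  | neg (v : Var) : Formula
  | or (φ ψ : Formula) : Formula
  | and (φ ψ : Formula) : Formula
  | dep (X Y : Finset Var) : Formula
  | negDep (X Y : Finset Var) : Formula

/-- An assignment of truth values to all variables. -/
abbrev Assignment : Type := Var → Bool

/-- A team is a set of assignments. -/
abbrev Team : Type := Set Assignment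

/-- The two conventions for falsum: no team at all satisfies it (`never`), or exactly the empty
team does (`emptyTeam`). They differ only in the value of falsum at the empty team. -/
inductive BotConvention : Type
  | never : BotConvention
  | emptyTeam : BotConvention

/-- `BotConvention.Holds c T`: the team `T` satisfies falsum under the convention `c`. -/
def BotConvention.Holds : BotConvention → Team → Prop
  | .never, _ => False
  | .emptyTeam, T => T = ∅

/-- Team semantics, with the lax reading of the split-junction. -/
def Satisfies (c : BotConvention) : Team → Formula → Prop
  | _, .top => True
  | T, .bot => c.Holds T
  | T, .pos v => ∀ t ∈ T, t v = true
  | T, .neg v => ∀ t ∈ T, t v = false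
  | T, .or φ ψ => ∃ T₁ T₂ : Team, T₁ ∪ T₂ = T ∧ Satisfies c T₁ φ ∧ Satisfies c T₂ ψ
  | T, .and φ ψ => Satisfies c T φ ∧ Satisfies c T ψ
  | T, .dep X Y => ∀ t ∈ T, ∀ t' ∈ T, (∀ p ∈ X, t p = t' p) → ∀ q ∈ Y, t q = t' q
  | T, .negDep _ _ => T = ∅

/-- A formula is satisfiable if some nonempty team satisfies it. -/
def Satisfiable (c : BotConvention) (Φ : Formula) : Prop :=
  ∃ T : Team, T.Nonempty ∧ Satisfies c T Φ

/-- The number of occurrences of the split-junction in a formula. -/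
def splits : Formula → ℕ
  | .or φ ψ => splits φ + splits ψ + 1
  | .and φ ψ => splits φ + splits ψ
  | _ => 0

/-- The finite alphabet in which formulas are written. -/
inductive Sym : Type
  | top | bot | pos | neg | or | and | dep | negDep
  | bit (b : Bool)
  | comma
  | semicolon
  | close
  deriving DecidableEq, Fintype

/-- A variable is written as its name followed by a comma. -/
def writeVar (v : Var) : List Sym := v.map Sym.bit ++ [Sym.comma]

/-- A list of variables is written by writing its members one after the other. -/
def writeVars (l : List Var) : List Sym := l.flatMap writeVar

/-- `Writes x Φ`: the word `x` is a way to write down the formula `Φ`, in prefix notation. The two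
sets of a dependence atom are written as lists of their members, in any order. -/
inductive Writes : List Sym → Formula → Prop
  | top : Writes [Sym.top] Formula.top
  | bot : Writes [Sym.bot] Formula.bot
  | pos (v : Var) : Writes (Sym.pos :: writeVar v) (Formula.pos v)
  | neg (v : Var) : Writes (Sym.neg :: writeVar v) (Formula.neg v)
  | or {x y : List Sym} {φ ψ : Formula} (hx : Writes x φ) (hy : Writes y ψ) :
      Writes (Sym.or :: (x ++ y)) (Formula.or φ ψ)
  | and {x y : List Sym} {φ ψ : Formula} (hx : Writes x φ) (hy : Writes y ψ) :
      Writes (Sym.and :: (x ++ y)) (Formula.and φ ψ)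
  | dep (l m : List Var) :
      Writes (Sym.dep :: (writeVars l ++ Sym.semicolon :: (writeVars m ++ [Sym.close])))
        (Formula.dep l.toFinset m.toFinset)
  | negDep (l m : List Var) :
      Writes (Sym.negDep :: (writeVars l ++ Sym.semicolon :: (writeVars m ++ [Sym.close])))
        (Formula.negDep l.toFinset m.toFinset)

/-- A deterministic multi-stack Turing machine with input alphabet `A` that outputs words over
`Bool`. All its stack alphabets are finite. -/
structure Machine (A : Type) extends Turing.TM2ComputableAux A Bool where
  finite_alphabet : ∀ k, Finite (tm.Γ k)

/-- Started on the input `w`, the machine halts after at most `t` steps, and its output is the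
single truth value of `P`. -/
def Machine.DecidesInTime {A : Type} (M : Machine A) (w : List A) (P : Prop) (t : ℕ) : Prop :=
  ∃ b : Bool, (b = true ↔ P) ∧
    Nonempty (Turing.TM2OutputsInTime M.tm (w.map M.inputAlphabet.symm)
      (some ([b].map M.outputAlphabet.symm)) t)

/-- A parameterised problem over the alphabet `A`. -/
abbrev ParamProblem (A : Type) : Type := Set (List A × ℕ)

/-- The word that presents the instance `x` with parameter value `k` to a machine: `k` tally marks
`none`, followed by `x`. -/
def inputWord {A : Type} (x : List A) (k : ℕ) : List (Option A) :=
  List.replicate k none ++ x.map some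

/-- Fixed-parameter tractability: some machine decides, for all `x` and `k`, whether `(x, k)` is in
the problem, in time `f k * p |x|` with `f` computable and `p` a polynomial. -/
def InFPT {A : Type} (P : ParamProblem A) : Prop :=
  ∃ (M : Machine (Option A)) (f : ℕ → ℕ) (p : Polynomial ℕ), Computable f ∧
    ∀ (x : List A) (k : ℕ),
      M.DecidesInTime (inputWord x k) ((x, k) ∈ P) (f k * p.eval x.length)

/-- The satisfiability problem of propositional dependence logic, parameterised by the number of
split-junctions. -/
def satBySplits (c : BotConvention) : ParamProblem Sym :=
  {q | ∃ Φ : Formula, Writes q.1 Φ ∧ q.2 = splits Φ ∧ Satisfiable c Φ}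

end PDL

/-! Satisfaction is downward closed (`Satisfies.mono`), so a satisfiable formula already holds in a
singleton team `{t}`. There every dependence atom is true and every negated one false. A
split-junction hands `t` to one disjunct and the empty team to the other (`satisfies_singleton_or`).
Once it is chosen at each split-junction which disjunct is kept, what remains is a conjunction of
literals on the kept part and the condition that the empty team satisfies the discarded parts. That
condition matters only when falsum fails in the empty team. Hence there are at most `2 ^ splits Φ`
choices, and each is tested in polynomial time: collect the kept literals and look for a
contradictory pair.

A choice is a bit attached to each symbol `or` of the word. A single pass with a stack of
keep/discard marks parses the word, tests the discarded parts and collects the literals. This pass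
is sound (`scan_of_writes`), complete (`exists_scan`), and succeeds only on words that represent
formulas (`exists_writes_of_scan`); `exists_good_iff` combines it with the consistency of the
literals (`pairwise_compatible_iff`).

The machine treats the choice bits as a binary counter, increments it between rounds and stops at a
good choice or at overflow (`runs_rounds`). A round takes cubic time: quadratically many letter
comparisons for each literal. For membership in FPT the machine first compares the number of symbols
`or` with the number of tally marks and rejects a mismatch, so that no input `(x, k)` costs more
than `2 ^ k` rounds. Without tally marks the same table gives the explicit bound. The algorithm is
written as a transition table on several stacks, which a `TM2` program simulates step by step
(`machine_evals`). -/

namespace TableMachine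

/-! ### Multi-stack transition tables and their simulation by `TM2`. -/

open Function

variable {K : Type} {Γ : K → Type} {Q : Type}

/-- The transition table of a deterministic multi-stack machine: from the control state and the
tops of all stacks, which are popped, it yields the next control state (`none` to halt) and the
words that are pushed. -/
abbrev Table (Γ : K → Type) (Q : Type) : Type :=
  Q → (∀ k, Option (Γ k)) → Option Q × (∀ k, List (Γ k))

/-- One step of a table machine. -/
def step (δ : Table Γ Q) :
    Option Q × (∀ k, List (Γ k)) → Option Q × (∀ k, List (Γ k))
  | (none, S) => (none, S)
  | (some q, S) =>
    ((δ q fun k => (S k).head?).1, fun k => (δ q fun k => (S k).head?).2 k ++ (S k).tail)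

/-- The configuration `y` is reached from `x` in at most `n` steps. -/
def RunsIn (δ : Table Γ Q) (n : ℕ) (x y : Option Q × (∀ k, List (Γ k))) : Prop :=
  ∃ m ≤ n, (step δ)^[m] x = y

theorem RunsIn.refl (δ : Table Γ Q) (n : ℕ) (x) : RunsIn δ n x x := ⟨0, Nat.zero_le _, rfl⟩

theorem RunsIn.single {δ : Table Γ Q} {x y} (h : step δ x = y) : RunsIn δ 1 x y :=
  ⟨1, le_rfl, h⟩

theorem RunsIn.mono {δ : Table Γ Q} {m n x y} (h : RunsIn δ m x y) (hmn : m ≤ n) :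
    RunsIn δ n x y := by
  obtain ⟨i, hi, h⟩ := h
  exact ⟨i, hi.trans hmn, h⟩

theorem RunsIn.trans {δ : Table Γ Q} {m n x y z} (h : RunsIn δ m x y) (h' : RunsIn δ n y z) :
    RunsIn δ (m + n) x z := by
  obtain ⟨i, hi, rfl⟩ := h
  obtain ⟨j, hj, rfl⟩ := h'
  exact ⟨j + i, by omega, iterate_add_apply _ _ _ _⟩

open Turing TM2 TM2.Stmt

variable [DecidableEq K]

/-- The internal state of the `TM2` program that runs a table: the control state and a buffer for
the popped symbols. -/
abbrev Buffer (Γ : K → Type) (Q : Type) : Type := Q × (∀ k, Option (Γ k))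

/-- Pop all stacks of a list into the buffer. -/
def popAll : List K → Stmt Γ Unit (Buffer Γ Q) → Stmt Γ Unit (Buffer Γ Q)
  | [], s => s
  | k :: ks, s => pop k (fun v o => (v.1, update v.2 k o)) (popAll ks s)

theorem stepAux_popAll (s : Stmt Γ Unit (Buffer Γ Q)) (q : Q) :
    ∀ (ks : List K), ks.Nodup → ∀ (T : ∀ k, Option (Γ k)) (S : ∀ k, List (Γ k)),
      stepAux (popAll ks s) (q, T) S =
        stepAux s (q, fun k => if k ∈ ks then (S k).head? else T k)
          (fun k => if k ∈ ks then (S k).tail else S k)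
  | [], _, T, S => by simp [popAll]
  | k :: ks, h, T, S => by
    obtain ⟨hk, hks⟩ := List.nodup_cons.1 h
    rw [popAll, stepAux, stepAux_popAll s q ks hks]
    congr 1
    · refine Prod.ext rfl (funext fun j => ?_)
      by_cases hj : j = k
      · subst hj; simp [hk]
      · simp [hj]
    · funext j
      by_cases hj : j = k
      · subst hj; simp [hk]
      · simp [hj]

/-- Push the first `n` letters of a word that depends on the internal state. -/
def pushWord {k : K} [Inhabited (Γ k)] (g : Buffer Γ Q → List (Γ k)) :
    ℕ → Stmt Γ Unit (Buffer Γ Q) → Stmt Γ Unit (Buffer Γ Q)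
  | 0, s => s
  | n + 1, s =>
    branch (fun v => decide (n < (g v).length)) (push k (fun v => (g v).getI n) (pushWord g n s))
      (pushWord g n s)

/-- The letter of index `n` is pushed before the shorter prefix, so the word lies on the stack in
its own order. -/
theorem stepAux_pushWord {k : K} [Inhabited (Γ k)] (g : Buffer Γ Q → List (Γ k))
    (s : Stmt Γ Unit (Buffer Γ Q)) (v : Buffer Γ Q) :
    ∀ (n : ℕ) (S : ∀ k, List (Γ k)), stepAux (pushWord g n s) v S =
      stepAux s v (update S k ((g v).take n ++ S k))
  | 0, S => by simp [pushWord]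
  | n + 1, S => by
    rw [pushWord, stepAux]
    by_cases h : n < (g v).length
    · rw [decide_eq_true h, cond_true, stepAux, stepAux_pushWord g s v n]
      rw [update_idem, update_self, List.getI_eq_getElem _ h, List.append_cons,
        List.take_concat_get' _ _ h]
    · rw [decide_eq_false h, cond_false, stepAux_pushWord g s v n,
        List.take_of_length_le (by omega), List.take_of_length_le (by omega)]

/-- Push the words that the table prescribes, each cut off after two letters. -/
def pushAll [∀ k, Inhabited (Γ k)] (δ : Table Γ Q) :
    List K → Stmt Γ Unit (Buffer Γ Q) → Stmt Γ Unit (Buffer Γ Q)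
  | [], s => s
  | k :: ks, s => pushWord (k := k) (fun v => (δ v.1 v.2).2 k) 2 (pushAll δ ks s)

theorem stepAux_pushAll [∀ k, Inhabited (Γ k)] (δ : Table Γ Q) (s : Stmt Γ Unit (Buffer Γ Q))
    (v : Buffer Γ Q) :
    ∀ (ks : List K), ks.Nodup → ∀ (S : ∀ k, List (Γ k)), stepAux (pushAll δ ks s) v S =
      stepAux s v (fun k => if k ∈ ks then ((δ v.1 v.2).2 k).take 2 ++ S k else S k)
  | [], _, S => by simp [pushAll]
  | k :: ks, h, S => by
    obtain ⟨hk, hks⟩ := List.nodup_cons.1 h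
    rw [pushAll, stepAux_pushWord, stepAux_pushAll δ s v ks hks]
    congr 1
    funext j
    by_cases hj : j = k
    · subst hj; simp [hk]
    · simp [hj]

/-- The `TM2` statement that performs one step of the table, for the list `ks` of all stacks. -/
def stmt [∀ k, Inhabited (Γ k)] (δ : Table Γ Q) (q₀ : Q) (ks : List K) :
    Stmt Γ Unit (Buffer Γ Q) :=
  popAll ks <| pushAll δ ks <|
    branch (fun v => (δ v.1 v.2).1.isSome)
      (load (fun v => ((δ v.1 v.2).1.getD q₀, fun _ => none)) (goto fun _ => ()))
      (load (fun _ => (q₀, fun _ => none)) halt)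

/-- The bound `hδ` makes the cut-off after two letters harmless. The buffer is cleared after each
step and the control state is reset to `q₀` on halting, because an output configuration must carry
the initial internal state. -/
theorem stepAux_stmt [∀ k, Inhabited (Γ k)] (δ : Table Γ Q) (hδ : ∀ q T k, ((δ q T).2 k).length ≤ 2)
    (q₀ : Q) (ks : List K) (hn : ks.Nodup) (hks : ∀ k, k ∈ ks) (q : Q) (S : ∀ k, List (Γ k)) :
    stepAux (stmt δ q₀ ks) (q, fun _ => none) S =
      ⟨(step δ (some q, S)).1.map fun _ => (), ((step δ (some q, S)).1.getD q₀, fun _ => none),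
        (step δ (some q, S)).2⟩ := by
  rw [stmt, stepAux_popAll _ _ _ hn, stepAux_pushAll _ _ _ _ hn, stepAux]
  simp only [hks, if_true, step, List.take_of_length_le (hδ _ _ _)]
  rcases h : (δ q fun k => (S k).head?).1 with _ | q' <;> simp [h]

/-- The bundled machine that runs a table. -/
noncomputable def machine [Fintype K] [∀ k, Inhabited (Γ k)] [∀ k, Finite (Γ k)] [Finite Q]
    (δ : Table Γ Q) (q₀ : Q) (k₀ k₁ : K) : FinTM2 where
  K := K
  k₀ := k₀
  k₁ := k₁
  Γ := Γ
  Λ := Unit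
  main := ()
  σ := Buffer Γ Q
  initialState := (q₀, fun _ => none)
  σFin := Fintype.ofFinite _
  Γk₀Fin := Fintype.ofFinite _
  m _ := stmt δ q₀ Finset.univ.toList

/-- A halted table idles, whereas a halted `TM2` has no next configuration. The induction therefore
stops at the first halting step, and `m` may be smaller than `n`. -/
theorem machine_evals [Fintype K] [∀ k, Inhabited (Γ k)] [∀ k, Finite (Γ k)] [Finite Q]
    (δ : Table Γ Q) (hδ : ∀ q T k, ((δ q T).2 k).length ≤ 2) (q₀ : Q) (k₀ k₁ : K)
    (S' : ∀ k, List (Γ k)) : ∀ (n : ℕ) (q : Q) (S : ∀ k, List (Γ k)),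
      (step δ)^[n] (some q, S) = (none, S') →
      ∃ m ≤ n, (flip bind (machine δ q₀ k₀ k₁).step)^[m]
        (some (⟨some (), (q, fun _ => none), S⟩ : Cfg Γ Unit (Buffer Γ Q))) =
          some (⟨none, (q₀, fun _ => none), S'⟩ : Cfg Γ Unit (Buffer Γ Q))
  | 0, q, S, h => by simp at h
  | n + 1, q, S, h => by
    have hs : flip bind (machine δ q₀ k₀ k₁).step
        (some (⟨some (), (q, fun _ => none), S⟩ : Cfg Γ Unit (Buffer Γ Q))) =
          some (⟨(step δ (some q, S)).1.map fun _ => (),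
            ((step δ (some q, S)).1.getD q₀, fun _ => none), (step δ (some q, S)).2⟩ :
            Cfg Γ Unit (Buffer Γ Q)) :=
      congrArg some (stepAux_stmt δ hδ q₀ _ (Finset.nodup_toList _) (by simp) q S)
    rw [iterate_succ_apply] at h
    rcases hx : step δ (some q, S) with ⟨_ | q', T⟩
    · have hfix : ∀ j, (step δ)^[j] (none, T) = (none, T) := fun j =>
        iterate_fixed rfl j
      rw [hx, hfix] at h
      obtain ⟨-, rfl⟩ := Prod.mk.inj h
      refine ⟨1, by omega, ?_⟩
      rw [iterate_one]
      refine hs.trans ?_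
      rw [hx]
      rfl
    · rw [hx] at h
      obtain ⟨m, hm, hm'⟩ := machine_evals δ hδ q₀ k₀ k₁ S' n q' T h
      refine ⟨m + 1, by omega, ?_⟩
      rw [iterate_succ_apply]
      refine (congrArg _ hs).trans ?_
      rw [hx]
      exact hm'

end TableMachine

namespace PDL

/-! ### Downward closure and reduction to singleton teams. -/

section Semantics

variable {c : BotConvention}

theorem Satisfies.mono {T S : Team} {Φ : Formula} (h : Satisfies c T Φ) (hST : S ⊆ T) :
    Satisfies c S Φ := by
  induction Φ generalizing T S with
  | top => trivial
  | bot =>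
    cases c
    · exact h
    · exact Set.subset_eq_empty hST h
  | pos v => exact fun t ht => h t (hST ht)
  | neg v => exact fun t ht => h t (hST ht)
  | or φ ψ hφ hψ =>
    obtain ⟨T₁, T₂, rfl, h₁, h₂⟩ := h
    refine ⟨T₁ ∩ S, T₂ ∩ S, ?_, hφ h₁ Set.inter_subset_left, hψ h₂ Set.inter_subset_left⟩
    rw [← Set.union_inter_distrib_right, Set.inter_eq_right.2 hST]
  | and φ ψ hφ hψ => exact ⟨hφ h.1 hST, hψ h.2 hST⟩
  | dep X Y => exact fun t ht t' ht' => h t (hST ht) t' (hST ht')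
  | negDep X Y => exact Set.subset_eq_empty hST h

theorem satisfiable_iff {Φ : Formula} :
    Satisfiable c Φ ↔ ∃ t : Assignment, Satisfies c {t} Φ := by
  constructor
  · rintro ⟨T, ⟨t, ht⟩, h⟩
    exact ⟨t, h.mono (Set.singleton_subset_iff.2 ht)⟩
  · rintro ⟨t, h⟩
    exact ⟨{t}, Set.singleton_nonempty t, h⟩

/-- One part of the split contains `t`; downward closure shrinks it to `{t}` and the other part to
`∅`. The conditions on `∅` cannot be dropped, since under `never` a formula may fail in the empty
team. -/
theorem satisfies_singleton_or {t : Assignment} {φ ψ : Formula} :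
    Satisfies c {t} (.or φ ψ) ↔
      (Satisfies c {t} φ ∧ Satisfies c ∅ ψ) ∨ (Satisfies c ∅ φ ∧ Satisfies c {t} ψ) := by
  constructor
  · rintro ⟨T₁, T₂, h, h₁, h₂⟩
    have ht : t ∈ T₁ ∪ T₂ := h ▸ Set.mem_singleton t
    rcases ht with ht | ht
    · exact .inl ⟨h₁.mono (Set.singleton_subset_iff.2 ht), h₂.mono (Set.empty_subset _)⟩
    · exact .inr ⟨h₁.mono (Set.empty_subset _), h₂.mono (Set.singleton_subset_iff.2 ht)⟩
  · rintro (⟨h₁, h₂⟩ | ⟨h₁, h₂⟩)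
    · exact ⟨_, _, Set.union_empty _, h₁, h₂⟩
    · exact ⟨_, _, Set.empty_union _, h₁, h₂⟩

end Semantics

/-! ### The one-pass scanner: soundness and completeness. -/

/-- The alphabet of the stack of collected literals. -/
inductive LitSym : Type
  | bit (b : Bool)
  | sign (p : Bool)
  deriving Fintype

/-- The state of the scanner: it expects a formula, is inside a literal of sign `p` that is kept
if `m`, is inside the first or second set of a dependence atom (where `fresh` says that no variable
is unfinished), or has failed. -/
inductive Mode : Type
  | node
  | lit (m p : Bool)
  | dep (second fresh : Bool)
  | fail
  deriving DecidableEq, Fintype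

/-- Whether the empty team violates falsum. -/
def BotConvention.isNever : BotConvention → Bool
  | .never => true
  | .emptyTeam => false

/-- The scanner reads a symbol with its choice bit. The top of the agenda, which says for the next
subformula whether it is kept or discarded, is replaced by the second component of the result, and
the third component is pushed onto the stack of literals. -/
def scanSym (c : BotConvention) :
    Mode → Option Bool → Sym → Bool → Mode × List Bool × List LitSym
  | .node, some _, .top, _ => (.node, [], [])
  | .node, some m, .bot, _ => (if m || c.isNever then .fail else .node, [], [])
  | .node, some m, .pos, _ => (.lit m true, [], [])
  | .node, some m, .neg, _ => (.lit m false, [], [])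
  | .node, some m, .and, _ => (.node, [m, m], [])
  | .node, some m, .or, g => (.node, [m && g, m && !g], [])
  | .node, some _, .dep, _ => (.dep false true, [], [])
  | .node, some m, .negDep, _ => (if m then .fail else .dep false true, [], [])
  | .lit m p, o, .bit b, _ => (.lit m p, o.toList, if m then [.bit b] else [])
  | .lit m p, o, .comma, _ => (.node, o.toList, if m then [.sign p] else [])
  | .dep s _, o, .bit _, _ => (.dep s false, o.toList, [])
  | .dep s _, o, .comma, _ => (.dep s true, o.toList, [])
  | .dep false true, o, .semicolon, _ => (.dep true true, o.toList, [])
  | .dep true true, o, .close, _ => (.node, o.toList, [])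
  | _, o, _, _ => (.fail, o.toList, [])

/-- A step of the scanner on its state, its agenda and its stack of literals. -/
def scanStep (c : BotConvention) (s : Mode × List Bool × List LitSym) (a : Sym × Bool) :
    Mode × List Bool × List LitSym :=
  ((scanSym c s.1 s.2.1.head? a.1 a.2).1, (scanSym c s.1 s.2.1.head? a.1 a.2).2.1 ++ s.2.1.tail,
    (scanSym c s.1 s.2.1.head? a.1 a.2).2.2 ++ s.2.2)

/-- The scanner reads a word with choice bits. -/
def scan (c : BotConvention) (s : Mode × List Bool × List LitSym) (y : List (Sym × Bool)) :
    Mode × List Bool × List LitSym :=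
  y.foldl (scanStep c) s

section Scan

variable (c : BotConvention)

@[simp] theorem scan_nil (s) : scan c s [] = s := rfl

@[simp] theorem scan_cons (s a y) : scan c s (a :: y) = scan c (scanStep c s a) y := rfl

theorem scan_append (s y z) : scan c s (y ++ z) = scan c (scan c s y) z := List.foldl_append

theorem scan_fail (y D L) : (scan c (.fail, D, L) y).1 = .fail := by
  induction y generalizing D L with
  | nil => rfl
  | cons a y ih => exact ih _ _

theorem length_scanSym_agenda (q o s g) :
    (scanSym c q o s g).2.1.length ≤ o.toList.length + 1 := by
  unfold scanSym
  split <;> simp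

theorem length_scanSym_lits (q o s g) : (scanSym c q o s g).2.2.length ≤ 1 := by
  unfold scanSym
  split <;> (try split) <;> simp

/-- A connective replaces one entry of the agenda by two, so each symbol adds at most one; this
bounds the time to clear the agenda. -/
theorem length_scan_agenda (s y) : (scan c s y).2.1.length ≤ s.2.1.length + y.length := by
  induction y generalizing s with
  | nil => rfl
  | cons a y ih =>
    have h := length_scanSym_agenda c s.1 s.2.1.head? a.1 a.2
    refine (ih _).trans ?_
    simp only [scanStep, List.length_append, List.length_tail, List.length_cons]
    rcases h' : s.2.1 with _ | ⟨d, D⟩ <;> rw [h'] at h <;> simp at h ⊢ <;> omega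

theorem length_scan_lits (s y) : (scan c s y).2.2.length ≤ s.2.2.length + y.length := by
  induction y generalizing s with
  | nil => rfl
  | cons a y ih =>
    have h := length_scanSym_lits c s.1 s.2.1.head? a.1 a.2
    refine (ih _).trans ?_
    simp only [scanStep, List.length_append, List.length_cons]
    omega

/-- The encoding of a collected literal: its sign, followed by the reversed name. -/
def encLit (e : Bool × List Bool) : List LitSym := LitSym.sign e.1 :: e.2.map LitSym.bit

/-- A collected literal is true under an assignment. -/
def LitTrue (t : Assignment) (e : Bool × List Bool) : Prop := t e.2.reverse = e.1

/-- The stack reverses the name written on it, and the sign arrives last, at the end marker, hence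
lies on top. -/
theorem scan_lit (m p : Bool) (D : List Bool) (v : Var) (y : List (Sym × Bool))
    (hy : y.map Prod.fst = writeVar v) (L : List LitSym) :
    scan c (.lit m p, D, L) y =
      (.node, D, (if m then encLit (p, v.reverse) else []) ++ L) := by
  induction v generalizing y L with
  | nil =>
    obtain ⟨⟨s, g⟩, y, rfl, rfl, h⟩ := List.map_eq_cons_iff.1 hy
    obtain rfl := List.map_eq_nil_iff.1 h
    cases D <;> cases m <;> rfl
  | cons b v ih =>
    obtain ⟨⟨s, g⟩, y, rfl, rfl, h⟩ := List.map_eq_cons_iff.1 hy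
    have : scanStep c (.lit m p, D, L) (Sym.bit b, g) =
        (.lit m p, D, (if m then [LitSym.bit b] else []) ++ L) := by
      cases D <;> rfl
    rw [scan_cons, this, ih y h]
    cases m <;> simp [encLit]

theorem scan_dep_var (s fresh : Bool) (D : List Bool) (v : Var) (y : List (Sym × Bool))
    (hy : y.map Prod.fst = writeVar v) (L : List LitSym) :
    scan c (.dep s fresh, D, L) y = (.dep s true, D, L) := by
  induction v generalizing y L fresh with
  | nil =>
    obtain ⟨⟨s, g⟩, y, rfl, rfl, h⟩ := List.map_eq_cons_iff.1 hy
    obtain rfl := List.map_eq_nil_iff.1 h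
    cases D <;> rfl
  | cons b v ih =>
    obtain ⟨⟨s', g⟩, y, rfl, rfl, h⟩ := List.map_eq_cons_iff.1 hy
    have : scanStep c (.dep s fresh, D, L) (Sym.bit b, g) = (.dep s false, D, L) := by
      cases D <;> rfl
    rw [scan_cons, this, ih false y h]

theorem scan_dep_vars (s : Bool) (D : List Bool) (l : List Var) (y : List (Sym × Bool))
    (hy : y.map Prod.fst = writeVars l) (L : List LitSym) :
    scan c (.dep s true, D, L) y = (.dep s true, D, L) := by
  induction l generalizing y with
  | nil =>
    obtain rfl := List.map_eq_nil_iff.1 hy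
    rfl
  | cons v l ih =>
    rw [writeVars, List.flatMap_cons] at hy
    obtain ⟨y₁, y₂, rfl, h₁, h₂⟩ := List.map_eq_append_iff.1 hy
    rw [scan_append, scan_dep_var c s true D v y₁ h₁, ih y₂ h₂]

theorem scan_dep (D : List Bool) (l m : List Var) (y : List (Sym × Bool))
    (hy : y.map Prod.fst = writeVars l ++ Sym.semicolon :: (writeVars m ++ [Sym.close]))
    (L : List LitSym) :
    scan c (.dep false true, D, L) y = (.node, D, L) := by
  obtain ⟨y₁, y₂, rfl, h₁, h₂⟩ := List.map_eq_append_iff.1 hy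
  obtain ⟨⟨s, g⟩, y', rfl, rfl, h'⟩ := List.map_eq_cons_iff.1 h₂
  obtain ⟨y₂, y₃, rfl, h₄, h₃⟩ := List.map_eq_append_iff.1 h'
  obtain ⟨⟨s, g⟩, y'', rfl, rfl, h''⟩ := List.map_eq_cons_iff.1 h₃
  obtain rfl := List.map_eq_nil_iff.1 h''
  have e₁ : ∀ g, scanStep c (.dep false true, D, L) (Sym.semicolon, g) = (.dep true true, D, L) :=
    fun g => by cases D <;> rfl
  have e₂ : ∀ g, scanStep c (.dep true true, D, L) (Sym.close, g) = (.node, D, L) :=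
    fun g => by cases D <;> rfl
  rw [scan_append, scan_dep_vars c false D l y₁ h₁, scan_cons, e₁, scan_append,
    scan_dep_vars c true D m y₂ h₄, scan_cons, e₂, scan_nil]

variable {c}

/-- Soundness for an arbitrary mark `m`, as the recursion meets both kept and discarded subformulas.
At a kept split-junction the marks `m && g` and `m && !g` keep exactly one disjunct, as in
`satisfies_singleton_or`. -/
theorem scan_of_writes {x : List Sym} {Φ : Formula} (hx : Writes x Φ) (m : Bool)
    (y : List (Sym × Bool)) (hy : y.map Prod.fst = x) (D : List Bool) (L : List LitSym) :
    (scan c (.node, m :: D, L) y).1 = .fail ∨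
      ∃ lits : List (Bool × List Bool),
        scan c (.node, m :: D, L) y = (.node, D, lits.flatMap encLit ++ L) ∧
        (m = false → Satisfies c ∅ Φ) ∧
        (m = true → ∀ t, (∀ e ∈ lits, LitTrue t e) → Satisfies c {t} Φ) := by
  induction hx generalizing m y D L with
  | top =>
    obtain ⟨⟨s, g⟩, y, rfl, rfl, h⟩ := List.map_eq_cons_iff.1 hy
    obtain rfl := List.map_eq_nil_iff.1 h
    exact .inr ⟨[], rfl, fun _ => trivial, fun _ _ _ => trivial⟩
  | bot =>
    obtain ⟨⟨s, g⟩, y, rfl, rfl, h⟩ := List.map_eq_cons_iff.1 hy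
    obtain rfl := List.map_eq_nil_iff.1 h
    cases m
    · cases c
      · exact .inl rfl
      · exact .inr ⟨[], rfl, fun _ => rfl, fun h => by simp at h⟩
    · exact .inl rfl
  | pos v =>
    obtain ⟨⟨s, g⟩, y, rfl, rfl, h⟩ := List.map_eq_cons_iff.1 hy
    refine .inr ⟨if m then [(true, v.reverse)] else [], ?_, fun _ _ h => by simp at h, ?_⟩
    · exact (scan_lit c m true D v y h L).trans (by cases m <;> simp)
    · rintro rfl t ht
      simpa [LitTrue, Satisfies] using ht
  | neg v =>
    obtain ⟨⟨s, g⟩, y, rfl, rfl, h⟩ := List.map_eq_cons_iff.1 hy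
    refine .inr ⟨if m then [(false, v.reverse)] else [], ?_, fun _ _ h => by simp at h, ?_⟩
    · exact (scan_lit c m false D v y h L).trans (by cases m <;> simp)
    · rintro rfl t ht
      simpa [LitTrue, Satisfies] using ht
  | or hx₁ hx₂ ih₁ ih₂ =>
    obtain ⟨⟨s, g⟩, y, rfl, rfl, h⟩ := List.map_eq_cons_iff.1 hy
    obtain ⟨y₁, y₂, rfl, h₁, h₂⟩ := List.map_eq_append_iff.1 h
    have e : scanStep c (.node, m :: D, L) (Sym.or, g) =
      (.node, (m && g) :: (m && !g) :: D, L) := rfl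
    rw [scan_cons, e, scan_append]
    rcases ih₁ (m && g) y₁ h₁ ((m && !g) :: D) L with h | ⟨lits₁, h, hE₁, hS₁⟩
    · left
      obtain ⟨D', L', h'⟩ : ∃ D' L', scan c (.node, (m && g) :: (m && !g) :: D, L) y₁ =
        (.fail, D', L') := ⟨_, _, Prod.ext h rfl⟩
      rw [h', scan_fail]
    · rw [h]
      rcases ih₂ (m && !g) y₂ h₂ D (lits₁.flatMap encLit ++ L) with h | ⟨lits₂, h, hE₂, hS₂⟩
      · exact .inl h
      · refine .inr ⟨lits₂ ++ lits₁, by rw [h]; simp, ?_, ?_⟩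
        · rintro rfl
          exact ⟨∅, ∅, Set.union_empty _, hE₁ rfl, hE₂ rfl⟩
        · rintro rfl t ht
          rw [satisfies_singleton_or]
          cases g
          · exact .inr ⟨hE₁ rfl, hS₂ rfl t fun e he => ht e (List.mem_append_left _ he)⟩
          · exact .inl ⟨hS₁ rfl t fun e he => ht e (List.mem_append_right _ he), hE₂ rfl⟩
  | and hx₁ hx₂ ih₁ ih₂ =>
    obtain ⟨⟨s, g⟩, y, rfl, rfl, h⟩ := List.map_eq_cons_iff.1 hy
    obtain ⟨y₁, y₂, rfl, h₁, h₂⟩ := List.map_eq_append_iff.1 h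
    have e : scanStep c (.node, m :: D, L) (Sym.and, g) = (.node, m :: m :: D, L) := rfl
    rw [scan_cons, e, scan_append]
    rcases ih₁ m y₁ h₁ (m :: D) L with h | ⟨lits₁, h, hE₁, hS₁⟩
    · left
      obtain ⟨D', L', h'⟩ : ∃ D' L', scan c (.node, m :: m :: D, L) y₁ =
        (.fail, D', L') := ⟨_, _, Prod.ext h rfl⟩
      rw [h', scan_fail]
    · rw [h]
      rcases ih₂ m y₂ h₂ D (lits₁.flatMap encLit ++ L) with h | ⟨lits₂, h, hE₂, hS₂⟩
      · exact .inl h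
      · exact .inr ⟨lits₂ ++ lits₁, by rw [h]; simp, fun hm => ⟨hE₁ hm, hE₂ hm⟩, fun hm t ht =>
          ⟨hS₁ hm t fun e he => ht e (List.mem_append_right _ he),
            hS₂ hm t fun e he => ht e (List.mem_append_left _ he)⟩⟩
  | dep l k =>
    obtain ⟨⟨s, g⟩, y, rfl, rfl, h⟩ := List.map_eq_cons_iff.1 hy
    refine .inr ⟨[], scan_dep c D l k y h L, fun _ t h => by simp at h, ?_⟩
    rintro - t - t₁ rfl t₂ rfl - q -
    rfl
  | negDep l k =>
    obtain ⟨⟨s, g⟩, y, rfl, rfl, h⟩ := List.map_eq_cons_iff.1 hy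
    cases m
    · exact .inr ⟨[], scan_dep c D l k y h L, fun _ => rfl, fun h => by simp at h⟩
    · exact .inl (scan_fail c y D L)

/-- Below a discarded node both marks `m && g` and `m && !g` are `false`, so the choice bits have no
influence and no literal is collected. -/
theorem scan_discarded {x : List Sym} {Φ : Formula} (hx : Writes x Φ) (hΦ : Satisfies c ∅ Φ)
    (y : List (Sym × Bool)) (hy : y.map Prod.fst = x) (D : List Bool) (L : List LitSym) :
    scan c (.node, false :: D, L) y = (.node, D, L) := by
  induction hx generalizing y D L with
  | top =>
    obtain ⟨⟨s, g⟩, y, rfl, rfl, h⟩ := List.map_eq_cons_iff.1 hy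
    obtain rfl := List.map_eq_nil_iff.1 h
    rfl
  | bot =>
    obtain ⟨⟨s, g⟩, y, rfl, rfl, h⟩ := List.map_eq_cons_iff.1 hy
    obtain rfl := List.map_eq_nil_iff.1 h
    cases c
    · exact hΦ.elim
    · rfl
  | pos v | neg v =>
    obtain ⟨⟨s, g⟩, y, rfl, rfl, h⟩ := List.map_eq_cons_iff.1 hy
    exact scan_lit c false _ D v y h L
  | or hx₁ hx₂ ih₁ ih₂ =>
    obtain ⟨⟨s, g⟩, y, rfl, rfl, h⟩ := List.map_eq_cons_iff.1 hy
    obtain ⟨y₁, y₂, rfl, h₁, h₂⟩ := List.map_eq_append_iff.1 h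
    obtain ⟨T₁, T₂, -, hT₁, hT₂⟩ := hΦ
    have e : scanStep c (.node, false :: D, L) (Sym.or, g) = (.node, false :: false :: D, L) := rfl
    rw [scan_cons, e, scan_append, ih₁ (hT₁.mono (Set.empty_subset _)) y₁ h₁,
      ih₂ (hT₂.mono (Set.empty_subset _)) y₂ h₂]
  | and hx₁ hx₂ ih₁ ih₂ =>
    obtain ⟨⟨s, g⟩, y, rfl, rfl, h⟩ := List.map_eq_cons_iff.1 hy
    obtain ⟨y₁, y₂, rfl, h₁, h₂⟩ := List.map_eq_append_iff.1 h
    have e : scanStep c (.node, false :: D, L) (Sym.and, g) = (.node, false :: false :: D, L) := rfl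
    rw [scan_cons, e, scan_append, ih₁ hΦ.1 y₁ h₁, ih₂ hΦ.2 y₂ h₂]
  | dep l k | negDep l k =>
    obtain ⟨⟨s, g⟩, y, rfl, rfl, h⟩ := List.map_eq_cons_iff.1 hy
    exact scan_dep c D l k y h L

/-- All symbols of the word other than split-junctions carry the choice bit `false`. -/
def Untagged (y : List (Sym × Bool)) : Prop := ∀ a ∈ y, a.1 ≠ Sym.or → a.2 = false

theorem exists_untagged (x : List Sym) : ∃ y : List (Sym × Bool), y.map Prod.fst = x ∧ Untagged y :=
  ⟨x.map fun s => (s, false), by simp [Function.comp_def], by simp [Untagged]⟩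

theorem Untagged.cons {s : Sym} {y : List (Sym × Bool)} (hy : Untagged y) :
    Untagged ((s, false) :: y) := by
  simpa [Untagged] using hy

theorem Untagged.or_cons {g : Bool} {y : List (Sym × Bool)} (hy : Untagged y) :
    Untagged ((Sym.or, g) :: y) := by
  simpa [Untagged] using hy

theorem Untagged.append {y z : List (Sym × Bool)} (hy : Untagged y) (hz : Untagged z) :
    Untagged (y ++ z) := by
  intro a ha
  rcases List.mem_append.1 ha with h | h
  · exact hy a h
  · exact hz a h

/-- Completeness: a kept split-junction is tagged with the disjunct that receives `t`, and all
irrelevant bits are set to `false`. This normalisation leaves one free bit per symbol `or`. -/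
theorem exists_scan {x : List Sym} {Φ : Formula} (hx : Writes x Φ) {t : Assignment}
    (hΦ : Satisfies c {t} Φ) :
    ∃ (y : List (Sym × Bool)) (lits : List (Bool × List Bool)), y.map Prod.fst = x ∧ Untagged y ∧
      (∀ e ∈ lits, LitTrue t e) ∧
      ∀ D L, scan c (.node, true :: D, L) y = (.node, D, lits.flatMap encLit ++ L) := by
  induction hx with
  | top =>
    exact ⟨[(Sym.top, false)], [], rfl, by simp [Untagged], by simp, fun _ _ => rfl⟩
  | bot =>
    cases c
    · exact hΦ.elim
    · exact (Set.singleton_ne_empty t hΦ).elim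
  | pos v =>
    obtain ⟨y, hy, hu⟩ := exists_untagged (writeVar v)
    refine ⟨(Sym.pos, false) :: y, [(true, v.reverse)], by simp [hy], hu.cons, ?_, fun D L => ?_⟩
    · simpa [LitTrue, Satisfies] using hΦ
    · exact (scan_lit c true true D v y hy L).trans (by simp)
  | neg v =>
    obtain ⟨y, hy, hu⟩ := exists_untagged (writeVar v)
    refine ⟨(Sym.neg, false) :: y, [(false, v.reverse)], by simp [hy], hu.cons, ?_, fun D L => ?_⟩
    · simpa [LitTrue, Satisfies] using hΦ
    · exact (scan_lit c true false D v y hy L).trans (by simp)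
  | @or x₁ x₂ φ ψ hx₁ hx₂ ih₁ ih₂ =>
    rcases satisfies_singleton_or.1 hΦ with ⟨h₁, h₂⟩ | ⟨h₁, h₂⟩
    · obtain ⟨y₁, lits, hy₁, hu₁, ht, hs⟩ := ih₁ h₁
      obtain ⟨y₂, hy₂, hu₂⟩ := exists_untagged x₂
      refine ⟨(Sym.or, true) :: (y₁ ++ y₂), lits, by simp [hy₁, hy₂], (hu₁.append hu₂).or_cons, ht,
        fun D L => ?_⟩
      have e : scanStep c (.node, true :: D, L) (Sym.or, true) =
        (.node, true :: false :: D, L) := rfl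
      rw [scan_cons, e, scan_append, hs, scan_discarded hx₂ h₂ y₂ hy₂]
    · obtain ⟨y₁, hy₁, hu₁⟩ := exists_untagged x₁
      obtain ⟨y₂, lits, hy₂, hu₂, ht, hs⟩ := ih₂ h₂
      refine ⟨(Sym.or, false) :: (y₁ ++ y₂), lits, by simp [hy₁, hy₂], (hu₁.append hu₂).or_cons, ht,
        fun D L => ?_⟩
      have e : scanStep c (.node, true :: D, L) (Sym.or, false) =
        (.node, false :: true :: D, L) := rfl
      rw [scan_cons, e, scan_append, scan_discarded hx₁ h₁ y₁ hy₁, hs]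
  | and hx₁ hx₂ ih₁ ih₂ =>
    obtain ⟨y₁, lits₁, hy₁, hu₁, ht₁, hs₁⟩ := ih₁ hΦ.1
    obtain ⟨y₂, lits₂, hy₂, hu₂, ht₂, hs₂⟩ := ih₂ hΦ.2
    refine ⟨(Sym.and, false) :: (y₁ ++ y₂), lits₂ ++ lits₁, by simp [hy₁, hy₂],
      (hu₁.append hu₂).cons, fun e he => ?_, fun D L => ?_⟩
    · rcases List.mem_append.1 he with h | h
      · exact ht₂ e h
      · exact ht₁ e h
    · have e : scanStep c (.node, true :: D, L) (Sym.and, false) =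
        (.node, true :: true :: D, L) := rfl
      rw [scan_cons, e, scan_append, hs₁, hs₂]
      simp
  | dep l k =>
    obtain ⟨y, hy, hu⟩ :=
      exists_untagged (writeVars l ++ Sym.semicolon :: (writeVars k ++ [Sym.close]))
    exact ⟨(Sym.dep, false) :: y, [], by simp [hy], hu.cons, by simp,
      fun D L => scan_dep c D l k y hy L⟩
  | negDep l k => exact (Set.singleton_ne_empty t hΦ).elim

/-! ### The scanner as a syntax check. -/

/-- The word is a concatenation of `n` words that represent formulas. -/
inductive WritesAll : ℕ → List Sym → Prop
  | nil : WritesAll 0 []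
  | cons {n : ℕ} {x z : List Sym} {Φ : Formula} (hx : Writes x Φ) (hz : WritesAll n z) :
      WritesAll (n + 1) (x ++ z)

/-- What the remaining input of the scanner looks like if it reads on successfully. -/
def Mode.Accepts : Mode → ℕ → List Sym → Prop
  | .node, n, x => WritesAll n x
  | .lit _ _, n, x => ∃ v z, x = writeVar v ++ z ∧ WritesAll n z
  | .dep false true, n, x => ∃ l m z,
      x = writeVars l ++ Sym.semicolon :: (writeVars m ++ Sym.close :: z) ∧ WritesAll n z
  | .dep false false, n, x => ∃ v l m z,
      x = writeVar v ++ (writeVars l ++ Sym.semicolon :: (writeVars m ++ Sym.close :: z)) ∧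
        WritesAll n z
  | .dep true true, n, x => ∃ m z, x = writeVars m ++ Sym.close :: z ∧ WritesAll n z
  | .dep true false, n, x => ∃ v m z,
      x = writeVar v ++ (writeVars m ++ Sym.close :: z) ∧ WritesAll n z
  | .fail, _, _ => False

theorem WritesAll.exists_of_succ {n : ℕ} {x : List Sym} (h : WritesAll (n + 1) x) :
    ∃ x₁ x₂ Φ, x = x₁ ++ x₂ ∧ Writes x₁ Φ ∧ WritesAll n x₂ := by
  cases h with
  | cons hx hz => exact ⟨_, _, _, rfl, hx, hz⟩

/-- The length of the agenda is the number of subformulas still expected. Failure is permanent, so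
each symbol read was legal, and it is put in front of the rest that the induction hypothesis has
parsed. -/
theorem accepts_of_scan {y : List (Sym × Bool)} {q : Mode} {D : List Bool} {L L' : List LitSym}
    (h : scan c (q, D, L) y = (.node, [], L')) : q.Accepts D.length (y.map Prod.fst) := by
  induction y generalizing q D L with
  | nil =>
    obtain ⟨rfl, rfl, -⟩ : q = .node ∧ D = [] ∧ L = L' := by simpa using h
    exact .nil
  | cons a y ih =>
    obtain ⟨s, g⟩ := a
    rw [scan_cons] at h
    have hs := ih h
    -- Inside a literal or an atom the top of the agenda is popped and pushed back, so its length is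
    -- unchanged.
    have ht : ∀ D : List Bool, D.head?.toList.length + (D.length - 1) = D.length := fun D => by
      cases D <;> simp
      omega
    have hq : (scanStep c (q, D, L) (s, g)).1 ≠ .fail := fun hq => by
      change (scanStep c (q, D, L) (s, g)).1.Accepts _ _ at hs
      rw [hq] at hs
      exact hs
    rw [List.map_cons]
    rcases q with _ | ⟨m, p⟩ | ⟨_ | _, fresh⟩ | _
    · rcases D with _ | ⟨d, D⟩
      · exact absurd rfl hq
      cases s
      case top => exact .cons .top hs
      case bot =>
        by_cases hd : (d || c.isNever) = true
        · simp [scanStep, scanSym, hd] at hq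
        · simp only [scanSym, List.head?, hd] at hs
          exact .cons .bot hs
      case pos =>
        obtain ⟨v, z, hz, hw⟩ := hs
        rw [hz]
        exact .cons (.pos v) hw
      case neg =>
        obtain ⟨v, z, hz, hw⟩ := hs
        rw [hz]
        exact .cons (.neg v) hw
      case or =>
        obtain ⟨x₁, x₂, φ, hx, h₁, h₂⟩ := WritesAll.exists_of_succ hs
        obtain ⟨x₂, x₃, ψ, rfl, h₂, h₃⟩ := WritesAll.exists_of_succ h₂
        rw [hx, ← List.append_assoc]
        exact .cons (.or h₁ h₂) h₃
      case and =>
        obtain ⟨x₁, x₂, φ, hx, h₁, h₂⟩ := WritesAll.exists_of_succ hs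
        obtain ⟨x₂, x₃, ψ, rfl, h₂, h₃⟩ := WritesAll.exists_of_succ h₂
        rw [hx, ← List.append_assoc]
        exact .cons (.and h₁ h₂) h₃
      case dep =>
        obtain ⟨l, m, z, hz, hw⟩ := hs
        rw [hz]
        have := WritesAll.cons (.dep l m) hw
        simp only [List.cons_append, List.append_assoc, List.nil_append] at this
        exact this
      case negDep =>
        cases d
        · obtain ⟨l, m, z, hz, hw⟩ := hs
          rw [hz]
          have := WritesAll.cons (.negDep l m) hw
          simp only [List.cons_append, List.append_assoc, List.nil_append] at this
          exact this
        · exact absurd rfl hq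
      all_goals exact absurd rfl hq
    · cases s
      case bit b =>
        simp only [scanSym, List.length_append, List.length_tail, ht] at hs
        obtain ⟨v, z, hz, hw⟩ := hs
        exact ⟨b :: v, z, by simp [hz, writeVar], hw⟩
      case comma =>
        simp only [scanSym, List.length_append, List.length_tail, ht] at hs
        exact ⟨[], _, rfl, hs⟩
      all_goals exact absurd rfl hq
    · cases s
      case bit b =>
        simp only [scanSym, List.length_append, List.length_tail, ht] at hs
        obtain ⟨v, l, m, z, hz, hw⟩ := hs
        cases fresh
        · exact ⟨b :: v, l, m, z, by simp [hz, writeVar], hw⟩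
        · exact ⟨(b :: v) :: l, m, z, by simp [hz, writeVar, writeVars], hw⟩
      case comma =>
        simp only [scanSym, List.length_append, List.length_tail, ht] at hs
        obtain ⟨l, m, z, hz, hw⟩ := hs
        cases fresh
        · exact ⟨[], l, m, z, by simp [hz, writeVar], hw⟩
        · exact ⟨[] :: l, m, z, by simp [hz, writeVar, writeVars], hw⟩
      case semicolon =>
        cases fresh
        · exact absurd rfl hq
        · simp only [scanSym, List.length_append, List.length_tail, ht] at hs
          obtain ⟨m, z, hz, hw⟩ := hs
          exact ⟨[], m, z, by simp [hz, writeVars], hw⟩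
      all_goals exact absurd (by cases fresh <;> rfl) hq
    · cases s
      case bit b =>
        simp only [scanSym, List.length_append, List.length_tail, ht] at hs
        obtain ⟨v, m, z, hz, hw⟩ := hs
        cases fresh
        · exact ⟨b :: v, m, z, by simp [hz, writeVar], hw⟩
        · exact ⟨(b :: v) :: m, z, by simp [hz, writeVar, writeVars], hw⟩
      case comma =>
        simp only [scanSym, List.length_append, List.length_tail, ht] at hs
        obtain ⟨m, z, hz, hw⟩ := hs
        cases fresh
        · exact ⟨[], m, z, by simp [hz, writeVar], hw⟩
        · exact ⟨[] :: m, z, by simp [hz, writeVar, writeVars], hw⟩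
      case close =>
        cases fresh
        · exact absurd rfl hq
        · simp only [scanSym, List.length_append, List.length_tail, ht] at hs
          exact ⟨[], _, by simp [writeVars], hs⟩
      all_goals exact absurd (by cases fresh <;> rfl) hq
    · exact absurd rfl hq

theorem exists_writes_of_scan {y : List (Sym × Bool)} {m : Bool} {L : List LitSym}
    (h : scan c (.node, [m], []) y = (.node, [], L)) : ∃ Φ, Writes (y.map Prod.fst) Φ := by
  obtain ⟨x₁, x₂, Φ, hx, h₁, h₂⟩ := WritesAll.exists_of_succ (accepts_of_scan h)
  cases h₂
  exact ⟨Φ, by simpa [hx] using h₁⟩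

/-! ### Consistency of literals and correctness of the search. -/

/-- Two collected literals do not contradict each other. -/
def Compatible (e e' : Bool × List Bool) : Prop := e.2 = e'.2 → e.1 = e'.1

theorem pairwise_compatible_iff {lits : List (Bool × List Bool)} :
    lits.Pairwise Compatible ↔ ∃ t, ∀ e ∈ lits, LitTrue t e := by
  constructor
  · intro h
    have : Std.Symm Compatible := ⟨fun _ _ h he => (h he.symm).symm⟩
    have h' : ∀ ⦃e⦄, e ∈ lits → ∀ ⦃e'⦄, e' ∈ lits → Compatible e e' :=
      h.forall_of_forall (fun _ _ _ => rfl)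
    -- Make true exactly the variables that occur in a positive literal; compatibility then protects
    -- the negative ones.
    refine ⟨fun v => decide ((true, v.reverse) ∈ lits), ?_⟩
    rintro ⟨p, u⟩ he
    cases p
    · simpa [LitTrue] using fun h => by simpa using h' he h rfl
    · simpa [LitTrue] using he
  · rintro ⟨t, ht⟩
    refine List.pairwise_iff_forall_sublist.2 fun {e e'} h hu => ?_
    have h₁ : LitTrue t e := ht e (h.subset (by simp))
    have h₂ : LitTrue t e' := ht e' (h.subset (by simp))
    rw [← h₁, ← h₂, hu]

/-- The scan of a tagged word succeeds and collects a consistent set of literals. -/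
def Good (c : BotConvention) (y : List (Sym × Bool)) : Prop :=
  ∃ lits : List (Bool × List Bool),
    scan c (.node, [true], []) y = (.node, [], lits.flatMap encLit) ∧ lits.Pairwise Compatible

theorem Good.exists_writes {y : List (Sym × Bool)} (h : Good c y) :
    ∃ Φ, Writes (y.map Prod.fst) Φ := by
  obtain ⟨lits, h, -⟩ := h
  exact exists_writes_of_scan h

theorem encLit_append_inj {u u' : List Bool} {l l' : List (Bool × List Bool)}
    (h : u.map LitSym.bit ++ l.flatMap encLit = u'.map LitSym.bit ++ l'.flatMap encLit) :
    u = u' ∧ l.flatMap encLit = l'.flatMap encLit := by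
  induction u generalizing u' with
  | nil =>
    cases u' with
    | nil => exact ⟨rfl, h⟩
    | cons b u' => cases l <;> simp [encLit] at h
  | cons b u ih =>
    cases u' with
    | nil => cases l' <;> simp [encLit] at h
    | cons b' u' =>
      simp only [List.map_cons, List.cons_append, List.cons.injEq, LitSym.bit.injEq] at h
      obtain ⟨rfl, h⟩ := h
      obtain ⟨rfl, h'⟩ := ih h
      exact ⟨rfl, h'⟩

/-- The signs delimit the names, so the contents of the stack determine the list of literals. -/
theorem flatMap_encLit_injective {l l' : List (Bool × List Bool)}
    (h : l.flatMap encLit = l'.flatMap encLit) : l = l' := by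
  induction l generalizing l' with
  | nil =>
    cases l' with
    | nil => rfl
    | cons e l' => simp [encLit] at h
  | cons e l ih =>
    cases l' with
    | nil => simp [encLit] at h
    | cons e' l' =>
      simp only [List.flatMap_cons, encLit, List.cons_append, List.cons.injEq,
        LitSym.sign.injEq] at h
      obtain ⟨h₁, h₂⟩ := encLit_append_inj h.2
      rw [ih h₂, Prod.ext h.1 h₁]

theorem exists_good_iff {x : List Sym} {Φ : Formula} (hx : Writes x Φ) :
    (∃ y, y.map Prod.fst = x ∧ Untagged y ∧ Good c y) ↔ Satisfiable c Φ := by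
  rw [satisfiable_iff]
  constructor
  · rintro ⟨y, hy, -, lits, h, hl⟩
    rcases scan_of_writes hx true y hy [] [] with h' | ⟨lits', h', -, hS⟩
    · rw [h] at h'
      simp at h'
    · obtain rfl : lits = lits' := by
        rw [h] at h'
        exact flatMap_encLit_injective (by simpa using h')
      obtain ⟨t, ht⟩ := pairwise_compatible_iff.1 hl
      exact ⟨t, hS rfl t ht⟩
  · rintro ⟨t, ht⟩
    obtain ⟨y, lits, hy, hu, hl, hs⟩ := exists_scan hx ht
    exact ⟨y, hy, hu, lits, by simpa using hs [] [], pairwise_compatible_iff.2 ⟨t, hl⟩⟩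

end Scan

theorem count_or_writeVar (v : Var) : (writeVar v).count Sym.or = 0 := by
  simp [writeVar, List.count_eq_zero]

theorem count_or_writeVars (l : List Var) : (writeVars l).count Sym.or = 0 := by
  simp [writeVars, List.count_eq_zero, writeVar]

/-- This lets the machine read the parameter off the word without parsing it. -/
theorem Writes.count_or {x : List Sym} {Φ : Formula} (hx : Writes x Φ) :
    x.count Sym.or = splits Φ := by
  induction hx with
  | or _ _ h₁ h₂ => simp [splits, h₁, h₂]
  | and _ _ h₁ h₂ => simp [splits, h₁, h₂]
  | _ => simp [splits, count_or_writeVar, count_or_writeVars]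

theorem Writes.length_pos {x : List Sym} {Φ : Formula} (hx : Writes x Φ) : 0 < x.length := by
  cases hx <;> simp

/-! ### The satisfiability machine. -/

open Function TableMachine

/-- The stacks of the satisfiability machine. -/
inductive StackName : Type
  | i | a | b | l | m | w | v
  deriving DecidableEq

instance : Fintype StackName := ⟨{.i, .a, .b, .l, .m, .w, .v}, fun k => by cases k <;> decide⟩

/-- The stack alphabets: `i` holds the input over `A`, `a` and `b` hold the formula with its choice
bits, `l` and `m` hold collected literals, and `w` and `v` hold truth values. -/
abbrev StackSym (A : Type) : StackName → Type
  | .i => A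
  | .a | .b => Sym × Bool
  | .l | .m => LitSym
  | .w | .v => Bool

/-- The contents of all stacks. -/
structure Words (A : Type) : Type where
  i : List A
  a : List (Sym × Bool)
  b : List (Sym × Bool)
  l : List LitSym
  m : List LitSym
  w : List Bool
  v : List Bool

namespace Words

variable {A : Type}

/-- The contents of the stacks as a function of the stack. -/
def get (W : Words A) : ∀ k, List (StackSym A k)
  | .i => W.i
  | .a => W.a
  | .b => W.b
  | .l => W.l
  | .m => W.m
  | .w => W.w
  | .v => W.v

end Words

/-- The control states of the satisfiability machine. -/
inductive Ctrl : Type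
  | load (bad : Bool)
  | rev (carry : Bool)
  | scan (q : Mode)
  | take
  | name (p : Bool)
  | restore (p q : Bool)
  | cmp (p q e : Bool)
  | back
  | clr
  | fin (r : Bool)
  deriving Fintype

/-- The transitions of the satisfiability machine.

* `load` moves the formula to `a`; `bad` says that it has more split-junctions than there are tally
  marks. The count is ignored unless `chk` holds.
* `rev` moves the formula to `b` and increments the binary number of the choice bits.
* `scan` moves the formula back to `a` and collects literals on `l`, with the agenda on `v`.
* `take`, `name` pop a literal of sign `p`. Then `restore`, `cmp` compare its name, kept on `w` and
  `v`, with the name of each other literal, where `q` is the sign of the latter and `e` says that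
  the names agree so far. Finally, `back` brings back the other literals.
* `clr` prepares the next round.
* `fin` empties all stacks and writes the answer. -/
def transition {A : Type} (c : BotConvention) (dec : A → Option Sym) (chk : Bool) :
    Ctrl → Option A → Option (Sym × Bool) → Option (Sym × Bool) → Option LitSym → Option LitSym →
      Option Bool → Option Bool → Option Ctrl × Words A
  | .load bad, some s, a, b, l, m, w, v =>
    match dec s with
    | none => (some (.load bad),
        ⟨[], a.toList, b.toList, l.toList, m.toList, true :: w.toList, v.toList⟩)
    | some s =>
      if s = .or then (some (.load (bad || (chk && w.isNone))),
        ⟨[], (s, false) :: a.toList, b.toList, l.toList, m.toList, [], v.toList⟩)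
      else (some (.load bad),
        ⟨[], (s, false) :: a.toList, b.toList, l.toList, m.toList, w.toList, v.toList⟩)
  | .load bad, none, a, b, l, m, w, v =>
    (some (if chk && (bad || w.isSome) then .fin false else .rev false),
      ⟨[], a.toList, b.toList, l.toList, m.toList, w.toList, v.toList⟩)
  | .rev cy, i, some (s, g), b, l, m, w, v =>
    if s = .or then (some (.rev (cy && g)),
      ⟨i.toList, [], (s, xor cy g) :: b.toList, l.toList, m.toList, w.toList, v.toList⟩)
    else (some (.rev cy),
      ⟨i.toList, [], (s, g) :: b.toList, l.toList, m.toList, w.toList, v.toList⟩)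
  | .rev cy, i, none, b, l, m, w, v =>
    if cy then (some (.fin false),
      ⟨i.toList, [], b.toList, l.toList, m.toList, w.toList, v.toList⟩)
    else (some (.scan .node),
      ⟨i.toList, [], b.toList, l.toList, m.toList, w.toList, true :: v.toList⟩)
  | .scan q, i, a, some (s, g), l, m, w, v =>
    (some (.scan (scanSym c q v s g).1),
      ⟨i.toList, (s, g) :: a.toList, [], (scanSym c q v s g).2.2 ++ l.toList, m.toList, w.toList,
        (scanSym c q v s g).2.1⟩)
  | .scan q, i, a, none, l, m, w, v =>
    (some (if q = .node ∧ v = none then .take else .clr),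
      ⟨i.toList, a.toList, [], l.toList, m.toList, w.toList, v.toList⟩)
  | .take, i, a, b, l, m, w, v =>
    match l with
    | some (.sign p) => (some (.name p),
        ⟨i.toList, a.toList, b.toList, [], m.toList, w.toList, v.toList⟩)
    | some (.bit _) => (some .clr,
        ⟨i.toList, a.toList, b.toList, l.toList, m.toList, w.toList, v.toList⟩)
    | none => (some (.fin true),
        ⟨i.toList, a.toList, b.toList, l.toList, m.toList, w.toList, v.toList⟩)
  | .name p, i, a, b, l, m, w, v =>
    match l with
    | some (.bit x) => (some (.name p),
        ⟨i.toList, a.toList, b.toList, [], m.toList, w.toList, x :: v.toList⟩)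
    | _ => (some (.restore p p),
        ⟨i.toList, a.toList, b.toList, l.toList, m.toList, w.toList, v.toList⟩)
  | .restore p q, i, a, b, l, m, w, some x =>
    (some (.restore p q),
      ⟨i.toList, a.toList, b.toList, l.toList, m.toList, x :: w.toList, []⟩)
  | .restore p q, i, a, b, l, m, w, none =>
    (some (.cmp p q true),
      ⟨i.toList, a.toList, b.toList, l.toList, m.toList, w.toList, []⟩)
  | .cmp p q e, i, a, b, l, m, w, v =>
    match l with
    | some (.bit x) =>
      if e = true ∧ w = some x then (some (.cmp p q true),
        ⟨i.toList, a.toList, b.toList, [], .bit x :: m.toList, [], x :: v.toList⟩)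
      else (some (.cmp p q false),
        ⟨i.toList, a.toList, b.toList, [], .bit x :: m.toList, w.toList, v.toList⟩)
    | some (.sign q') =>
      if e = true ∧ w = none ∧ p ≠ q then (some .clr,
        ⟨i.toList, a.toList, b.toList, l.toList, m.toList, w.toList, v.toList⟩)
      else (some (.restore p q'),
        ⟨i.toList, a.toList, b.toList, [], .sign q' :: m.toList, w.toList, v.toList⟩)
    | none =>
      (some (if e = true ∧ w = none ∧ p ≠ q then .clr else .back),
        ⟨i.toList, a.toList, b.toList, l.toList, m.toList, w.toList, v.toList⟩)
  | .back, i, a, b, l, m, w, v =>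
    (some (if m = none ∧ w = none ∧ v = none then .take else .back),
      ⟨i.toList, a.toList, b.toList, m.toList ++ l.toList, [], [], []⟩)
  | .clr, i, a, b, l, m, w, v =>
    (some (if l = none ∧ m = none ∧ w = none ∧ v = none then .rev true else .clr),
      ⟨i.toList, a.toList, b.toList, [], [], [], []⟩)
  | .fin r, i, a, b, l, m, w, v =>
    if i = none ∧ a = none ∧ b = none ∧ l = none ∧ m = none ∧ w = none ∧ v = none then
      (none, ⟨[], [], [], [], [], [r], []⟩)
    else (some (.fin r), ⟨[], [], [], [], [], [], []⟩)

/-! ### Single steps and elementary loops of the machine. -/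

section Machine

variable {A : Type} (c : BotConvention) (dec : A → Option Sym) (chk : Bool)

/-- The transition table of the satisfiability machine. -/
def table : Table (StackSym A) Ctrl := fun q T =>
  ((transition c dec chk q (T .i) (T .a) (T .b) (T .l) (T .m) (T .w) (T .v)).1,
    (transition c dec chk q (T .i) (T .a) (T .b) (T .l) (T .m) (T .w) (T .v)).2.get)

theorem length_toList_le {α : Type} (o : Option α) : o.toList.length ≤ 1 := by
  cases o <;> simp

theorem length_table_le (q T k) : ((table c dec chk q T).2 k).length ≤ 2 := by
  have h := @length_toList_le
  simp only [table]
  generalize T .i = i, T .a = a, T .b = b, T .l = l, T .m = m, T .w = w, T .v = v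
  have hi := h i
  have ha := h a
  have hb := h b
  have hl := h l
  have hm := h m
  have hw := h w
  have hv := h v
  unfold transition
  split <;> (try split) <;> (try split) <;> cases k <;>
    simp only [Words.get, List.length_cons, List.length_append, List.length_nil] <;>
    first
    | omega
    | exact (length_scanSym_agenda c _ _ _ _).trans (by omega)
    | exact (Nat.add_le_add (length_scanSym_lits c _ _ _ _) hl)

/-- One step of the satisfiability machine on the contents of its stacks. -/
def next (q : Ctrl) (W : Words A) : Option Ctrl × Words A :=
  let r := transition c dec chk q W.i.head? W.a.head? W.b.head? W.l.head? W.m.head? W.w.head?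
    W.v.head?
  (r.1, ⟨r.2.i ++ W.i.tail, r.2.a ++ W.a.tail, r.2.b ++ W.b.tail, r.2.l ++ W.l.tail,
    r.2.m ++ W.m.tail, r.2.w ++ W.w.tail, r.2.v ++ W.v.tail⟩)

/-- From the control state `q`, with stack contents `W`, the machine gets within `n` steps to the
control state `q'`, with stack contents `W'`. -/
def Runs (n : ℕ) (q : Ctrl) (W : Words A) (q' : Option Ctrl) (W' : Words A) : Prop :=
  RunsIn (table c dec chk) n (some q, W.get) (q', W'.get)

variable {c dec chk}

theorem step_table (q : Ctrl) (W : Words A) :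
    step (table c dec chk) (some q, W.get) =
      ((next c dec chk q W).1, (next c dec chk q W).2.get) := by
  refine Prod.ext rfl (funext fun k => ?_)
  cases k <;> rfl

theorem Runs.refl (n : ℕ) (q : Ctrl) (W : Words A) : Runs c dec chk n q W (some q) W :=
  RunsIn.refl _ _ _

theorem Runs.single {q : Ctrl} {W W' : Words A} {q' : Option Ctrl}
    (h : next c dec chk q W = (q', W')) : Runs c dec chk 1 q W q' W' :=
  RunsIn.single (by rw [step_table, h])

theorem Runs.mono {m n : ℕ} {q : Ctrl} {W W' : Words A} {q' : Option Ctrl}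
    (h : Runs c dec chk m q W q' W') (hmn : m ≤ n) : Runs c dec chk n q W q' W' :=
  RunsIn.mono h hmn

theorem Runs.trans {m n : ℕ} {q q₁ : Ctrl} {W W₁ W' : Words A} {q' : Option Ctrl}
    (h : Runs c dec chk m q W (some q₁) W₁) (h' : Runs c dec chk n q₁ W₁ q' W') :
    Runs c dec chk (m + n) q W q' W' :=
  RunsIn.trans h h'

theorem Runs.head {n : ℕ} {q q₁ : Ctrl} {W W₁ W' : Words A} {q' : Option Ctrl}
    (h : next c dec chk q W = (some q₁, W₁)) (h' : Runs c dec chk n q₁ W₁ q' W') :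
    Runs c dec chk (n + 1) q W q' W' :=
  ((Runs.single h).trans h').mono (by omega)

@[simp] theorem toList_head?_append_tail {α : Type} (s : List α) : s.head?.toList ++ s.tail = s := by
  cases s <;> rfl

/-- The binary increment of the choice bits, least significant bit first, with its carry. -/
def increment : Bool → List (Sym × Bool) → Bool × List (Sym × Bool)
  | cy, [] => (cy, [])
  | cy, (s, g) :: y =>
    if s = .or then ((increment (cy && g) y).1, (s, xor cy g) :: (increment (cy && g) y).2)
    else ((increment cy y).1, (s, g) :: (increment cy y).2)

theorem runs_rev (cy : Bool) (y : List (Sym × Bool)) (i b l m w v) :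
    Runs c dec chk y.length (.rev cy) ⟨i, y, b, l, m, w, v⟩ (some (.rev (increment cy y).1))
      ⟨i, [], (increment cy y).2.reverse ++ b, l, m, w, v⟩ := by
  induction y generalizing cy b with
  | nil => exact Runs.refl _ _ _
  | cons a y ih =>
    obtain ⟨s, g⟩ := a
    by_cases hs : s = .or
    · refine Runs.head (by simp [next, transition, hs]; exact ⟨rfl, rfl⟩) ?_
      simpa [increment, hs] using ih (cy && g) ((s, xor cy g) :: b)
    · refine Runs.head (by simp [next, transition, hs]; exact ⟨rfl, rfl⟩) ?_
      simpa [increment, hs] using ih cy ((s, g) :: b)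

theorem runs_scan (q : Mode) (y : List (Sym × Bool)) (i a l m w v) :
    Runs c dec chk y.length (.scan q) ⟨i, a, y, l, m, w, v⟩
      (some (.scan (scan c (q, v, l) y).1))
      ⟨i, y.reverse ++ a, [], (scan c (q, v, l) y).2.2, m, w, (scan c (q, v, l) y).2.1⟩ := by
  induction y generalizing q a l v with
  | nil => exact Runs.refl _ _ _
  | cons x y ih =>
    refine Runs.head (q₁ := .scan (scanStep c (q, v, l) x).1) (W₁ := ⟨i, x :: a, y,
      (scanStep c (q, v, l) x).2.2, m, w, (scanStep c (q, v, l) x).2.1⟩) ?_ ?_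
    · simp [next, transition, scanStep]
    · simpa using ih _ _ _ _

theorem runs_clr (n : ℕ) (W : Words A) (hl : W.l.length ≤ n) (hm : W.m.length ≤ n)
    (hw : W.w.length ≤ n) (hv : W.v.length ≤ n) :
    Runs c dec chk (n + 1) .clr W (some (.rev true)) ⟨W.i, W.a, W.b, [], [], [], []⟩ := by
  induction n generalizing W with
  | zero =>
    obtain ⟨i, a, b, l, m, w, v⟩ := W
    simp only [Nat.le_zero, List.length_eq_zero_iff] at hl hm hw hv
    subst hl hm hw hv
    exact Runs.single (by simp [next, transition])
  | succ n ih =>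
    by_cases h : W.l = [] ∧ W.m = [] ∧ W.w = [] ∧ W.v = []
    · refine (Runs.single ?_).mono (Nat.le_add_left 1 _)
      simp [next, transition, h]
    · refine Runs.head (q₁ := .clr)
        (W₁ := ⟨W.i, W.a, W.b, W.l.tail, W.m.tail, W.w.tail, W.v.tail⟩) ?_ ?_
      · simp [next, transition, h]
      · exact ih _ (by simp; omega) (by simp; omega) (by simp; omega) (by simp; omega)

theorem runs_fin (n : ℕ) (r : Bool) (W : Words A) (hi : W.i.length ≤ n) (ha : W.a.length ≤ n)
    (hb : W.b.length ≤ n) (hl : W.l.length ≤ n) (hm : W.m.length ≤ n)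
    (hw : W.w.length ≤ n) (hv : W.v.length ≤ n) :
    Runs c dec chk (n + 1) (.fin r) W none ⟨[], [], [], [], [], [r], []⟩ := by
  induction n generalizing W with
  | zero =>
    obtain ⟨i, a, b, l, m, w, v⟩ := W
    simp only [Nat.le_zero, List.length_eq_zero_iff] at hi ha hb hl hm hw hv
    subst hi ha hb hl hm hw hv
    exact Runs.single (by simp [next, transition])
  | succ n ih =>
    by_cases h : W.i = [] ∧ W.a = [] ∧ W.b = [] ∧ W.l = [] ∧ W.m = [] ∧ W.w = [] ∧ W.v = []
    · refine (Runs.single ?_).mono (Nat.le_add_left 1 _)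
      simp [next, transition, h]
    · refine Runs.head (q₁ := .fin r)
        (W₁ := ⟨W.i.tail, W.a.tail, W.b.tail, W.l.tail, W.m.tail, W.w.tail, W.v.tail⟩) ?_ ?_
      · simp [next, transition, h]
      · exact ih _ (by simp; omega) (by simp; omega) (by simp; omega) (by simp; omega)
          (by simp; omega) (by simp; omega) (by simp; omega)

end Machine

/-! ### The consistency check on the collected literals. -/

section Consistency

variable {A : Type} {c : BotConvention} {dec : A → Option Sym} {chk : Bool}
  {i : List A} {a b : List (Sym × Bool)}

theorem runs_name (p : Bool) (u : List Bool) (l m w v) :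
    Runs c dec chk u.length (.name p) ⟨i, a, b, u.map LitSym.bit ++ l, m, w, v⟩
      (some (.name p)) ⟨i, a, b, l, m, w, u.reverse ++ v⟩ := by
  induction u generalizing v with
  | nil => exact Runs.refl _ _ _
  | cons x u ih =>
    refine Runs.head (by simp [next, transition]; exact ⟨rfl, rfl⟩) ?_
    simpa using ih (x :: v)

theorem runs_restore (p q : Bool) (l m w v) :
    Runs c dec chk (v.length + 1) (.restore p q) ⟨i, a, b, l, m, w, v⟩
      (some (.cmp p q true)) ⟨i, a, b, l, m, v.reverse ++ w, []⟩ := by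
  induction v generalizing w with
  | nil => exact Runs.single (by simp [next, transition])
  | cons x v ih =>
    refine Runs.head (by simp [next, transition]; exact ⟨rfl, rfl⟩) ?_
    simpa using ih (x :: w)

/-- The matched prefix moves from `w` to `v`; after the first mismatch `e` is `false` and the
remaining letters are skipped. So `v.reverse ++ w` always spells the stored name, and the names
agree when `e` survives and `w` is used up. -/
theorem runs_cmp_name (p q e : Bool) (u : List Bool) (l m w v) :
    ∃ e' w' v', v'.reverse ++ w' = v.reverse ++ w ∧ (e' = true ∧ w' = [] ↔ e = true ∧ w = u) ∧
      Runs c dec chk u.length (.cmp p q e) ⟨i, a, b, u.map LitSym.bit ++ l, m, w, v⟩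
        (some (.cmp p q e')) ⟨i, a, b, l, (u.map LitSym.bit).reverse ++ m, w', v'⟩ := by
  induction u generalizing e m w v with
  | nil => exact ⟨e, w, v, rfl, Iff.rfl, Runs.refl _ _ _⟩
  | cons x u ih =>
    by_cases h : e = true ∧ w.head? = some x
    · obtain ⟨rfl, hw⟩ := h
      obtain ⟨w, rfl⟩ : ∃ w₁, w = x :: w₁ := by
        cases w with
        | nil => simp at hw
        | cons y w => exact ⟨w, by simpa using hw⟩
      obtain ⟨e', w', v', h₁, h₂, h₃⟩ := ih true (.bit x :: m) w (x :: v)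
      refine ⟨e', w', v', by simpa using h₁, by simpa using h₂,
        Runs.head (by simp [next, transition]; exact ⟨rfl, rfl⟩) ?_⟩
      simpa using h₃
    · obtain ⟨e', w', v', h₁, h₂, h₃⟩ := ih false (.bit x :: m) w v
      refine ⟨e', w', v', h₁, ?_,
        Runs.head (by simp [next, transition, h]; exact ⟨rfl, rfl⟩) ?_⟩
      · rw [h₂]
        refine iff_of_false (by simp) ?_
        rintro ⟨rfl, rfl⟩
        simp at h
      · simpa using h₃

theorem length_flatMap_encLit_cons (q : Bool) (u : List Bool) (lits : List (Bool × List Bool)) :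
    (((q, u) :: lits).flatMap encLit).length = u.length + 1 + (lits.flatMap encLit).length := by
  simp [encLit]
  omega

/-- Letters leaving `l` arrive on `m`, which keeps the total in `hN` within `N` throughout the
induction. The verdict on a literal falls when the next sign, or the end of `l`, is seen. -/
theorem runs_cmp (N : ℕ) (p q : Bool) (u : List Bool) (lits : List (Bool × List Bool)) (m w)
    (hN : u.length + (lits.flatMap encLit).length + m.length + w.length ≤ N) :
    ((∀ x ∈ (q, u) :: lits, Compatible (p, w) x) ∧ ∃ w' v', v'.reverse ++ w' = w ∧
      Runs c dec chk ((lits.length + 1) * (2 * N + 3)) (.cmp p q true)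
        ⟨i, a, b, u.map LitSym.bit ++ lits.flatMap encLit, m, w, []⟩
        (some .back)
        ⟨i, a, b, [], (u.map LitSym.bit ++ lits.flatMap encLit).reverse ++ m, w', v'⟩) ∨
    ((¬ ∀ x ∈ (q, u) :: lits, Compatible (p, w) x) ∧ ∃ l' m' w' v', l'.length ≤ N ∧
      m'.length ≤ N ∧ w'.length ≤ N ∧ v'.length ≤ N ∧
      Runs c dec chk ((lits.length + 1) * (2 * N + 3)) (.cmp p q true)
        ⟨i, a, b, u.map LitSym.bit ++ lits.flatMap encLit, m, w, []⟩
        (some .clr) ⟨i, a, b, l', m', w', v'⟩) := by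
  induction lits generalizing q u m with
  | nil =>
    obtain ⟨e', w', v', h₁, h₂, h₃⟩ := runs_cmp_name (c := c) (dec := dec) (chk := chk) (i := i)
      (a := a) (b := b) p q true u [] m w []
    have hl : v'.length + w'.length = w.length := by simpa using congrArg List.length h₁
    simp only [List.flatMap_nil, List.length_nil] at hN
    by_cases h : e' = true ∧ w' = [] ∧ p ≠ q
    · refine .inr ⟨?_, [], (u.map LitSym.bit).reverse ++ m, w', v', by simp, by simp; omega,
        by omega, by omega, (h₃.trans (Runs.single ?_)).mono (by simp; omega)⟩
      · intro hc
        exact h.2.2 (hc (q, u) (by simp) (h₂.1 ⟨h.1, h.2.1⟩).2)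
      · generalize (u.map LitSym.bit).reverse ++ m = m'
        simp [next, transition, h]
    · refine .inl ⟨?_, w', v', by simpa using h₁,
        (h₃.trans (Runs.single ?_)).mono (by simp; omega)⟩
      · intro x hx
        obtain rfl : x = (q, u) := by simpa using hx
        intro hw
        by_contra hpq
        obtain ⟨h₄, h₅⟩ := h₂.2 ⟨rfl, hw⟩
        exact h ⟨h₄, h₅, hpq⟩
      · have h' : ¬ (e' = true ∧ w' = [] ∧ ¬ p = q) := h
        simp only [List.flatMap_nil, List.append_nil]
        generalize (u.map LitSym.bit).reverse ++ m = m'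
        simp [next, transition, h']
  | cons x lits ih =>
    obtain ⟨q', u'⟩ := x
    obtain ⟨e', w', v', h₁, h₂, h₃⟩ := runs_cmp_name (c := c) (dec := dec) (chk := chk) (i := i)
      (a := a) (b := b) p q true u (((q', u') :: lits).flatMap encLit) m w []
    have hl : v'.length + w'.length = w.length := by simpa using congrArg List.length h₁
    have hN' : u.length + (u'.length + 1 + (lits.flatMap encLit).length) + m.length + w.length
        ≤ N := by
      rwa [length_flatMap_encLit_cons] at hN
    -- One comparison takes at most `N` letters, one step for the sign and `N + 1` steps to restore
    -- the name, within the allotted `2 * N + 3`.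
    have hT : (((q', u') :: lits).length + 1) * (2 * N + 3) =
      (lits.length + 1) * (2 * N + 3) + (2 * N + 3) := by simp; ring
    by_cases h : e' = true ∧ w' = [] ∧ p ≠ q
    · refine .inr ⟨?_, ((q', u') :: lits).flatMap encLit, (u.map LitSym.bit).reverse ++ m, w', v',
        by omega, by simp; omega,
        by omega, by omega, (h₃.trans (Runs.single ?_)).mono (by rw [hT]; omega)⟩
      · intro hc
        exact h.2.2 (hc (q, u) (by simp) (h₂.1 ⟨h.1, h.2.1⟩).2)
      · generalize (u.map LitSym.bit).reverse ++ m = m'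
        simp [next, transition, h, encLit]
    · have hc : Compatible (p, w) (q, u) := by
        intro hw
        by_contra hpq
        obtain ⟨h₄, h₅⟩ := h₂.2 ⟨rfl, hw⟩
        exact h ⟨h₄, h₅, hpq⟩
      have h' : ¬ (e' = true ∧ w' = [] ∧ ¬ p = q) := h
      have hw : v'.reverse ++ w' = w := by simpa using h₁
      have hr := h₃.trans (Runs.head (q₁ := .restore p q') (W₁ := ⟨i, a, b,
        u'.map LitSym.bit ++ lits.flatMap encLit,
        .sign q' :: ((u.map LitSym.bit).reverse ++ m), w', v'⟩)
        (by generalize (u.map LitSym.bit).reverse ++ m = m'; simp [next, transition, h', encLit]) (runs_restore p q' _ _ _ _))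
      rw [hw] at hr
      rcases ih q' u' (.sign q' :: ((u.map LitSym.bit).reverse ++ m))
          (by
            simp only [List.length_cons, List.length_append, List.length_reverse, List.length_map]
            omega) with
        ⟨hC, w₁, v₁, h₄, h₅⟩ | ⟨hC, l₁, m₁, w₁, v₁, h₄, h₅, h₆, h₇, h₈⟩
      · refine .inl ⟨List.forall_mem_cons.2 ⟨hc, hC⟩, w₁, v₁, h₄, ?_⟩
        have := (hr.trans h₅).mono (n := (lits.length + 1) * (2 * N + 3) + (2 * N + 3)) (by omega)
        rw [hT]
        simpa [encLit] using this
      · refine .inr ⟨fun h => hC (List.forall_mem_cons.1 h).2, l₁, m₁, w₁, v₁, h₄, h₅, h₆, h₇, ?_⟩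
        rw [hT]
        exact (hr.trans h₈).mono (by omega)

theorem runs_back (n : ℕ) (l m w v) (hm : m.length ≤ n) (hw : w.length ≤ n) (hv : v.length ≤ n) :
    Runs c dec chk (n + 1) .back ⟨i, a, b, l, m, w, v⟩
      (some .take) ⟨i, a, b, m.reverse ++ l, [], [], []⟩ := by
  induction n generalizing l m w v with
  | zero =>
    simp only [Nat.le_zero, List.length_eq_zero_iff] at hm hw hv
    subst hm hw hv
    exact Runs.single (by simp [next, transition])
  | succ n ih =>
    by_cases h : m = [] ∧ w = [] ∧ v = []
    · refine (Runs.single ?_).mono (Nat.le_add_left 1 _)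
      simp [next, transition, h]
    · refine Runs.head (q₁ := .back)
        (W₁ := ⟨i, a, b, m.head?.toList ++ l, m.tail, w.tail, v.tail⟩) ?_ ?_
      · simp [next, transition, h]
      · convert ih (m.head?.toList ++ l) m.tail w.tail v.tail (by simp; omega) (by simp; omega)
          (by simp; omega) using 2
        cases m <;> simp

/-- A bound on the time to compare one literal with the others. -/
def literalTime (N : ℕ) : ℕ := (N + 1) * (2 * N + 3) + 3 * N + 4

theorem length_le_length_flatMap_encLit (lits : List (Bool × List Bool)) :
    lits.length ≤ (lits.flatMap encLit).length := by
  induction lits with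
  | nil => simp
  | cons x lits ih => simp [encLit] at ih ⊢; omega

theorem runs_take (N : ℕ) (lits : List (Bool × List Bool))
    (hN : (lits.flatMap encLit).length ≤ N) :
    (lits.Pairwise Compatible ∧ Runs c dec chk (lits.length * literalTime N + 1) .take
      ⟨i, a, b, lits.flatMap encLit, [], [], []⟩ (some (.fin true)) ⟨i, a, b, [], [], [], []⟩) ∨
    (¬ lits.Pairwise Compatible ∧ ∃ l' m' w' v', l'.length ≤ N ∧
      m'.length ≤ N ∧ w'.length ≤ N ∧ v'.length ≤ N ∧
      Runs c dec chk (lits.length * literalTime N + 1) .take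
        ⟨i, a, b, lits.flatMap encLit, [], [], []⟩ (some .clr) ⟨i, a, b, l', m', w', v'⟩) := by
  induction lits with
  | nil => exact .inl ⟨.nil, (Runs.single (by simp [next, transition])).mono (by simp)⟩
  | cons x lits ih =>
    obtain ⟨p, u⟩ := x
    have hN' : u.length + (lits.flatMap encLit).length + 1 ≤ N := by
      rw [length_flatMap_encLit_cons] at hN
      omega
    have hlen := length_le_length_flatMap_encLit lits
    have hT : ((p, u) :: lits).length * literalTime N + 1 =
      literalTime N + (lits.length * literalTime N + 1) := by simp; ring
    have hmul : (lits.length + 1) * (2 * N + 3) ≤ (N + 1) * (2 * N + 3) :=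
      Nat.mul_le_mul_right _ (by omega)
    have hr : Runs c dec chk (2 * N + 2) .take
        ⟨i, a, b, ((p, u) :: lits).flatMap encLit, [], [], []⟩ (some (.cmp p p true))
        ⟨i, a, b, lits.flatMap encLit, [], u, []⟩ := by
      have h₁ := runs_name (c := c) (dec := dec) (chk := chk) (i := i) (a := a) (b := b) p u
        (lits.flatMap encLit) [] [] []
      have h₂ := runs_restore (c := c) (dec := dec) (chk := chk) (i := i) (a := a) (b := b) p p
        (lits.flatMap encLit) [] [] (u.reverse ++ [])
      have h₃ : next c dec chk (.name p)
          ⟨i, a, b, lits.flatMap encLit, [], [], u.reverse ++ []⟩ =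
          (some (.restore p p), ⟨i, a, b, lits.flatMap encLit, [], [], u.reverse ++ []⟩) := by
        generalize u.reverse ++ [] = v
        cases lits <;> simp [next, transition, encLit]
      have h₄ := Runs.head (q := .take) (c := c) (dec := dec) (chk := chk)
        (W := ⟨i, a, b, ((p, u) :: lits).flatMap encLit, [], [], []⟩)
        (by simp [next, transition, encLit]) (h₁.trans (Runs.head h₃ h₂))
      simpa using h₄.mono (n := 2 * N + 2)
        (by simp only [List.append_nil, List.length_reverse]; omega)
    -- The comparison starts with a dummy literal `(p, [])`. It has the sign of the stored literal,
    -- so it can never contradict it.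
    rcases runs_cmp (c := c) (dec := dec) (chk := chk) (i := i) (a := a) (b := b) N p p [] lits [] u
      (by simp only [List.length_nil]; omega) with
      ⟨hC, w₁, v₁, h₄, h₅⟩ | ⟨hC, l₁, m₁, w₁, v₁, h₄, h₅, h₆, h₇, h₈⟩
    · have hl : v₁.length + w₁.length = u.length := by simpa using congrArg List.length h₄
      have hb := runs_back (c := c) (dec := dec) (chk := chk) (i := i) (a := a) (b := b) N []
        (([].map LitSym.bit ++ lits.flatMap encLit).reverse ++ []) w₁ v₁
        (by simp only [List.map_nil, List.nil_append, List.append_nil, List.length_reverse]; omega)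
        (by omega) (by omega)
      have hr' := (hr.trans (h₅.trans hb)).mono (n := literalTime N)
        (by unfold literalTime; omega)
      simp only [List.map_nil, List.nil_append, List.append_nil, List.reverse_reverse] at hr'
      rcases ih (by omega) with ⟨hP, h⟩ | ⟨hP, l₂, m₂, w₂, v₂, g₁, g₂, g₃, g₄, h⟩
      · exact .inl ⟨.cons (List.forall_mem_cons.1 hC).2 hP, hT ▸ hr'.trans h⟩
      · exact .inr ⟨fun h => hP (List.pairwise_cons.1 h).2, l₂, m₂, w₂, v₂, g₁, g₂, g₃, g₄,
          hT ▸ hr'.trans h⟩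
    · refine .inr ⟨fun h => hC (List.forall_mem_cons.2 ⟨fun _ => rfl, (List.pairwise_cons.1 h).1⟩),
        l₁, m₁, w₁, v₁, h₄, h₅, h₆, h₇, (hr.trans h₈).mono ?_⟩
      rw [hT]
      unfold literalTime
      omega

end Consistency

/-! ### Choice bits as a binary counter. -/

/-- Attach the binary digits of `n`, least significant digit first, to the split-junctions of a
word as choice bits. -/
def tag : ℕ → List Sym → List (Sym × Bool)
  | _, [] => []
  | n, s :: r => if s = .or then (s, decide (n % 2 = 1)) :: tag (n / 2) r else (s, false) :: tag n r

theorem map_fst_tag (n : ℕ) (r : List Sym) : (tag n r).map Prod.fst = r := by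
  induction r generalizing n with
  | nil => rfl
  | cons s r ih => by_cases hs : s = .or <;> simp [tag, hs, ih]

theorem length_tag (n : ℕ) (r : List Sym) : (tag n r).length = r.length := by
  simpa using congrArg List.length (map_fst_tag n r)

theorem untagged_tag (n : ℕ) (r : List Sym) : Untagged (tag n r) := by
  induction r generalizing n with
  | nil => simp [tag, Untagged]
  | cons s r ih =>
    by_cases hs : s = .or
    · simpa [tag, hs] using (ih _).or_cons
    · simpa [tag, hs] using (ih _).cons

theorem tag_zero (r : List Sym) : tag 0 r = r.map fun s => (s, false) := by
  induction r with
  | nil => rfl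
  | cons s r ih => by_cases hs : s = .or <;> simp [tag, hs, ih]

theorem Untagged.exists_tag {y : List (Sym × Bool)} (hy : Untagged y) :
    ∃ n < 2 ^ (y.map Prod.fst).count Sym.or, y = tag n (y.map Prod.fst) := by
  induction y with
  | nil => exact ⟨0, by simp, rfl⟩
  | cons x y ih =>
    obtain ⟨s, g⟩ := x
    obtain ⟨n, hn, hy'⟩ := ih fun a ha => hy a (List.mem_cons_of_mem _ ha)
    by_cases hs : s = .or
    · subst hs
      refine ⟨2 * n + g.toNat, ?_, ?_⟩
      · have := g.toNat_le
        simp only [List.map_cons, List.count_cons_self, pow_succ]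
        omega
      · have h₁ : (2 * n + g.toNat) / 2 = n := by
          have := g.toNat_lt
          omega
        have h₂ : decide ((2 * n + g.toNat) % 2 = 1) = g := by cases g <;> simp
        simp only [List.map_cons, tag, if_true, h₁, h₂, ← hy']
    · obtain rfl : g = false := hy (s, g) (by simp) hs
      refine ⟨n, ?_, ?_⟩
      · simpa [List.count_cons, hs] using hn
      · simp only [List.map_cons, tag, if_neg hs, ← hy']

theorem increment_false (y : List (Sym × Bool)) : increment false y = (false, y) := by
  induction y with
  | nil => rfl
  | cons x y ih =>
    obtain ⟨s, g⟩ := x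
    by_cases hs : s = .or <;> simp [increment, hs, ih]

theorem length_increment (cy : Bool) (y : List (Sym × Bool)) :
    (increment cy y).2.length = y.length := by
  induction y generalizing cy with
  | nil => rfl
  | cons x y ih =>
    obtain ⟨s, g⟩ := x
    by_cases hs : s = .or <;> simp [increment, hs, ih]

/-- A last digit `0` absorbs the carry and leaves `n / 2` alone; a last digit `1` passes it on to `n
/ 2`. The carry leaves the word exactly at the last choice. -/
theorem increment_tag (n : ℕ) (r : List Sym) :
    (n + 1 < 2 ^ r.count Sym.or → increment true (tag n r) = (false, tag (n + 1) r)) ∧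
      (n + 1 = 2 ^ r.count Sym.or → (increment true (tag n r)).1 = true) := by
  induction r generalizing n with
  | nil => simp [tag, increment]
  | cons s r ih =>
    by_cases hs : s = .or
    · subst hs
      simp only [List.count_cons_self, pow_succ, tag, if_true, increment, Bool.true_and]
      rcases Nat.mod_two_eq_zero_or_one n with h | h
      · have h₁ : (n + 1) / 2 = n / 2 := by omega
        have h₂ : (n + 1) % 2 = 1 := by omega
        refine ⟨fun _ => ?_, fun h' => by omega⟩
        simp [h, increment_false, h₁, h₂]
      · have h₁ : (n + 1) / 2 = n / 2 + 1 := by omega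
        have h₂ : (n + 1) % 2 = 0 := by omega
        refine ⟨fun h' => ?_, fun h' => ?_⟩
        · simp [h, (ih (n / 2)).1 (by omega), h₁, h₂]
        · simpa [h] using (ih (n / 2)).2 (by omega)
    · simp only [List.count_cons, beq_iff_eq, hs, if_false, add_zero, tag, increment]
      exact ⟨fun h' => by rw [(ih n).1 h'], (ih n).2⟩

/-- The counter lives on the reversed word, because `load` reverses the input; the scanner reads it
the right way round again. -/
theorem exists_tag_good_iff {c : BotConvention} (x : List Sym) :
    (∃ n < 2 ^ x.count Sym.or, Good c (tag n x.reverse).reverse) ↔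
      ∃ y, y.map Prod.fst = x ∧ Untagged y ∧ Good c y := by
  constructor
  · rintro ⟨n, -, h⟩
    refine ⟨_, ?_, fun a ha => ?_, h⟩
    · rw [List.map_reverse, map_fst_tag, List.reverse_reverse]
    · exact untagged_tag n x.reverse a (List.mem_reverse.1 ha)
  · rintro ⟨y, rfl, hu, h⟩
    have hu' : Untagged y.reverse := fun a ha => hu a (List.mem_reverse.1 ha)
    obtain ⟨n, hn, hy⟩ := hu'.exists_tag
    rw [List.map_reverse] at hn hy
    rw [List.count_reverse] at hn
    exact ⟨n, hn, by rwa [← hy, List.reverse_reverse]⟩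

/-- A bound on the time that the machine spends on one choice of the choice bits. -/
def roundTime (N : ℕ) : ℕ := N * literalTime N + 3 * N + 5

/-! ### Rounds of the search and the total running time. -/

section Rounds

variable {A : Type} {c : BotConvention} {dec : A → Option Sym} {chk : Bool}

theorem runs_round (cy : Bool) (y z : List (Sym × Bool)) (h : increment cy y = (false, z)) :
    (Good c z.reverse ∧ Runs c dec chk (roundTime y.length) (.rev cy) ⟨[], y, [], [], [], [], []⟩
      (some (.fin true)) ⟨[], z, [], [], [], [], []⟩) ∨
    (¬ Good c z.reverse ∧ Runs c dec chk (roundTime y.length) (.rev cy)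
      ⟨[], y, [], [], [], [], []⟩ (some (.rev true)) ⟨[], z, [], [], [], [], []⟩) := by
  have hz : z.length = y.length := by simpa [h] using length_increment cy y
  rcases hs : scan c (.node, [true], []) z.reverse with ⟨q, D, L⟩
  have hD : D.length ≤ y.length + 1 := by
    have := length_scan_agenda c (.node, [true], []) z.reverse
    simp [hs] at this
    omega
  have hL : L.length ≤ y.length := by
    have := length_scan_lits c (.node, [true], []) z.reverse
    simp [hs] at this
    omega
  have h₁ := runs_rev (c := c) (dec := dec) (chk := chk) cy y [] [] [] [] [] []
  have h₂ := runs_scan (c := c) (dec := dec) (chk := chk) .node z.reverse [] [] [] [] [] [true]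
  rw [h, List.append_nil] at h₁
  rw [hs] at h₂
  have h₃ := h₁.trans (Runs.head (by generalize z.reverse = b; simp [next, transition]) h₂)
  simp only [List.reverse_reverse, List.append_nil, List.length_reverse, hz] at h₃
  by_cases hq : q = .node ∧ D = []
  · obtain ⟨rfl, rfl⟩ := hq
    -- A successful scan certifies that the word is a formula, which gives `L` the shape of encoded
    -- literals that `runs_take` needs.
    obtain ⟨Φ, hΦ⟩ := exists_writes_of_scan hs
    obtain ⟨lits, hl⟩ : ∃ lits : List (Bool × List Bool), L = lits.flatMap encLit := by
      rcases scan_of_writes hΦ true z.reverse rfl [] [] with h' | ⟨lits, h', -⟩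
      · rw [hs] at h'
        cases h'
      · rw [hs] at h'
        exact ⟨lits, by simpa using h'⟩
    subst hl
    have h₄ := h₃.trans (Runs.single (q' := some .take) (W' := ⟨[], z, [], lits.flatMap encLit, [],
      [], []⟩) (by simp [next, transition]))
    have hT : lits.length * literalTime y.length ≤ y.length * literalTime y.length :=
      Nat.mul_le_mul_right _ ((length_le_length_flatMap_encLit lits).trans hL)
    have hG : Good c z.reverse ↔ lits.Pairwise Compatible := by
      constructor
      · rintro ⟨lits', h', hP⟩
        rw [hs] at h'
        rwa [flatMap_encLit_injective (Prod.mk.inj (Prod.mk.inj h').2).2]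
      · exact fun hP => ⟨lits, hs, hP⟩
    rcases runs_take (c := c) (dec := dec) (chk := chk) (i := []) (a := z) (b := []) y.length lits
      hL with ⟨hP, h₅⟩ | ⟨hP, l, m, w, v, hl, hm, hw, hv, h₅⟩
    · exact .inl ⟨hG.2 hP, (h₄.trans h₅).mono (by unfold roundTime; omega)⟩
    · exact .inr ⟨fun h => hP (hG.1 h), ((h₄.trans h₅).trans (runs_clr y.length _ hl hm hw hv)).mono
        (by unfold roundTime; omega)⟩
  · have h₄ := h₃.trans (Runs.single (q' := some .clr) (W' := ⟨[], z, [], L, [], [], D⟩)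
      (by simp [next, transition, hq]))
    refine .inr ⟨?_, (h₄.trans (runs_clr (y.length + 1) _ (by dsimp only; omega) (by simp) (by simp)
      hD)).mono (by unfold roundTime; omega)⟩
    rintro ⟨lits, h', -⟩
    rw [hs] at h'
    obtain ⟨h₅, h₆⟩ := Prod.mk.inj h'
    exact hq ⟨h₅, (Prod.mk.inj h₆).1⟩

/-- Here `j` counts the choices after `n`. The carry `cy` is a variable since the first round tests
the counter without incrementing it, while all later rounds enter with carry `true`. -/
theorem runs_rounds (r : List Sym) (j n : ℕ) (hn : n + 1 + j = 2 ^ r.count Sym.or) (cy : Bool)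
    (y : List (Sym × Bool)) (hy : increment cy y = (false, tag n r)) :
    ∃ res a b, a.length ≤ r.length ∧ b.length ≤ r.length ∧
      (res = true ↔ ∃ n' < 2 ^ r.count Sym.or, n ≤ n' ∧ Good c (tag n' r).reverse) ∧
      Runs c dec chk ((j + 1) * roundTime r.length + r.length + 1) (.rev cy)
        ⟨[], y, [], [], [], [], []⟩ (some (.fin res)) ⟨[], a, b, [], [], [], []⟩ := by
  induction j generalizing n cy y with
  | zero =>
    have hl : y.length = r.length := by
      rw [← length_tag n r, ← length_increment cy y, hy]
    rcases runs_round (c := c) (dec := dec) (chk := chk) cy y _ hy with ⟨hG, h⟩ | ⟨hG, h⟩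
    · refine ⟨true, tag n r, [], by rw [length_tag], by simp, ?_, h.mono (by rw [hl]; omega)⟩
      simpa using ⟨n, by omega, le_rfl, hG⟩
    · refine ⟨false, [], (increment true (tag n r)).2.reverse, by simp,
        by simp [length_increment, length_tag], ?_, ?_⟩
      · simp only [Bool.false_eq_true, false_iff]
        rintro ⟨n', h₁, h₂, h₃⟩
        obtain rfl : n = n' := by omega
        exact hG h₃
      · have h₁ := runs_rev (c := c) (dec := dec) (chk := chk) true (tag n r) [] [] [] [] [] []
        rw [(increment_tag n r).2 hn, List.append_nil] at h₁
        generalize (increment true (tag n r)).2.reverse = b at h₁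
        have h₂ := (h.trans h₁).trans (Runs.single (q' := some (.fin false))
          (W' := ⟨[], [], b, [], [], [], []⟩) (by simp [next, transition]))
        exact h₂.mono (by rw [hl, length_tag]; omega)
  | succ j ih =>
    have hl : y.length = r.length := by
      rw [← length_tag n r, ← length_increment cy y, hy]
    rcases runs_round (c := c) (dec := dec) (chk := chk) cy y _ hy with ⟨hG, h⟩ | ⟨hG, h⟩
    · refine ⟨true, tag n r, [], by rw [length_tag], by simp, ?_, h.mono ?_⟩
      · simpa using ⟨n, by omega, le_rfl, hG⟩
      · rw [hl, add_one_mul]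
        omega
    · obtain ⟨res, a, b, ha, hb, hres, h'⟩ :=
        ih (n + 1) (by omega) true (tag n r) ((increment_tag n r).1 (by omega))
      refine ⟨res, a, b, ha, hb, hres.trans ⟨?_, ?_⟩, (h.trans h').mono ?_⟩
      · rintro ⟨n', h₁, h₂, h₃⟩
        exact ⟨n', h₁, by omega, h₃⟩
      · rintro ⟨n', h₁, h₂, h₃⟩
        refine ⟨n', h₁, ?_, h₃⟩
        rcases h₂.eq_or_lt with rfl | h₂
        · exact absurd h₃ hG
        · exact h₂
      · rw [hl, add_one_mul (j + 1)]
        omega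

theorem runs_load_tally (u : List A) (k : ℕ) (hu : u.map dec = List.replicate k none) (bad : Bool)
    (i a b l m w v) :
    Runs c dec chk k (.load bad) ⟨u ++ i, a, b, l, m, w, v⟩
      (some (.load bad)) ⟨i, a, b, l, m, List.replicate k true ++ w, v⟩ := by
  induction k generalizing u w with
  | zero =>
    obtain rfl := List.map_eq_nil_iff.1 hu
    exact Runs.refl _ _ _
  | succ k ih =>
    obtain ⟨x, u, rfl, hx, hu⟩ := List.map_eq_cons_iff.1 hu
    refine Runs.head (by simp [next, transition, hx]; exact ⟨rfl, rfl⟩) ?_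
    simpa [List.replicate_succ'] using ih u hu (true :: w)

/-- Each `or` cancels a tally mark. The truncated difference records only a surplus of marks; a
deficit is remembered by the flag. -/
theorem runs_load_word (u : List A) (x : List Sym) (hu : u.map dec = x.map some) (k : ℕ)
    (bad : Bool) (a b l m v) :
    Runs c dec chk x.length (.load bad) ⟨u, a, b, l, m, List.replicate k true, v⟩
      (some (.load (bad || (chk && decide (k < x.count Sym.or)))))
      ⟨[], x.reverse.map (fun s => (s, false)) ++ a, b, l, m,
        List.replicate (k - x.count Sym.or) true, v⟩ := by
  induction x generalizing u k bad a with
  | nil =>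
    obtain rfl := List.map_eq_nil_iff.1 hu
    simpa using Runs.refl _ _ _
  | cons s x ih =>
    obtain ⟨x', u, rfl, hx, hu'⟩ := List.map_eq_cons_iff.1 hu
    by_cases hs : s = .or
    · subst hs
      cases k with
      | zero =>
        refine Runs.head (by simp [next, transition, hx]; exact ⟨rfl, rfl⟩) ?_
        have := ih u hu' 0 (bad || chk) ((Sym.or, false) :: a)
        cases chk <;> simpa using this
      | succ k =>
        refine Runs.head (by simp [next, transition, hx]; exact ⟨rfl, rfl⟩) ?_
        simpa [List.replicate_succ] using ih u hu' k bad ((Sym.or, false) :: a)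
    · generalize hw : List.replicate k true = w
      refine Runs.head (by simp [next, transition, hx, hs]; exact ⟨rfl, rfl⟩) ?_
      subst hw
      simpa [List.count_cons, hs] using ih u hu' k bad ((s, false) :: a)

/-- A bound on the time of the satisfiability machine on a word of length `N` after `k` tally
marks, if it goes through `2 ^ e` choices. -/
def totalTime (k e N : ℕ) : ℕ := 2 * k + 3 * N + 3 + 2 ^ e * roundTime N

/-- A failed comparison with the tally marks ends the run before any enumeration, so with `chk` the
exponent is `k` however many symbols `or` occur. Without `chk`, `h₀` ensures that no marks are left
on `w` when the rounds begin. -/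
theorem runs_decide (u : List A) (k : ℕ) (x : List Sym)
    (hu : u.map dec = List.replicate k none ++ x.map some) (h₀ : chk = false → k = 0) :
    ∃ res, (res = true ↔ (chk = true → x.count Sym.or = k) ∧
        ∃ y, y.map Prod.fst = x ∧ Untagged y ∧ Good c y) ∧
      Runs c dec chk (totalTime k (if chk then k else x.count Sym.or) x.length) (.load false)
        ⟨u, [], [], [], [], [], []⟩ none ⟨[], [], [], [], [], [res], []⟩ := by
  obtain ⟨u₁, u₂, rfl, h₁, h₂⟩ := List.map_eq_append_iff.1 hu
  have l₁ := runs_load_tally (c := c) (chk := chk) u₁ k h₁ false u₂ [] [] [] [] [] []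
  have l₂ := runs_load_word (c := c) (chk := chk) u₂ x h₂ k false [] [] [] [] []
  rw [List.append_nil] at l₁ l₂
  have l₃ := l₁.trans l₂
  rw [Bool.false_or, ← tag_zero] at l₃
  by_cases hk : chk = true ∧ x.count Sym.or ≠ k
  · obtain ⟨rfl, hk⟩ := hk
    have l₄ := l₃.trans (Runs.single (q' := some (.fin false)) (W' := ⟨[], tag 0 x.reverse, [], [],
      [], List.replicate (k - x.count Sym.or) true, []⟩) (by
        rcases lt_or_gt_of_ne hk with h | h
        · obtain ⟨j, hj⟩ : ∃ j, k - x.count Sym.or = j + 1 := ⟨k - x.count Sym.or - 1, by omega⟩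
          simp [next, transition, hj, List.replicate_succ]
        · have hj : k - x.count Sym.or = 0 := by omega
          simp [next, transition, hj, h]))
    refine ⟨false, ?_, (l₄.trans (runs_fin (k + x.length) false _ ?_ ?_ ?_ ?_ ?_ ?_ ?_)).mono ?_⟩
    · simp [hk]
    all_goals simp [totalTime, length_tag]
    all_goals omega
  · have hk' : chk = true → x.count Sym.or = k := fun h => by
      by_contra h'
      exact hk ⟨h, h'⟩
    have he : (if chk then k else x.count Sym.or) = x.count Sym.or := by
      split
      · rename_i h
        exact (hk' h).symm
      · rfl
    have hj : k - x.count Sym.or = 0 := by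
      cases chk
      · simp [h₀ rfl]
      · simp [hk' rfl]
    have hb : (chk && decide (k < x.count Sym.or)) = false := by
      cases chk
      · rfl
      · simp [hk' rfl]
    rw [hj, hb, List.replicate_zero] at l₃
    have l₄ := l₃.trans (Runs.single (q' := some (.rev false)) (W' := ⟨[], tag 0 x.reverse, [], [],
      [], [], []⟩) (by
        generalize tag 0 x.reverse = a
        simp [next, transition]))
    have h2 := Nat.one_le_two_pow (n := x.reverse.count Sym.or)
    obtain ⟨res, a, b, ha, hb, hres, hr⟩ := runs_rounds (c := c) (dec := dec) (chk := chk) x.reverse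
      (2 ^ x.reverse.count Sym.or - 1) 0 (by omega) false _ (increment_false _)
    refine ⟨res, ?_, ((l₄.trans hr).trans (runs_fin x.length res _ ?_ ?_ ?_ ?_ ?_ ?_ ?_)).mono ?_⟩
    · rw [hres, ← exists_tag_good_iff, List.count_reverse]
      simp only [zero_le, true_and]
      exact ⟨fun h => ⟨hk', h⟩, fun h => h.2⟩
    · simp
    · simpa using ha
    · simpa using hb
    iterate 4 simp
    rw [he, Nat.sub_add_cancel h2, List.count_reverse, List.length_reverse, totalTime]
    omega

end Rounds

/-! ### The bundled machine and the two claims. -/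

section Main

variable {A : Type}

instance : Inhabited Sym := ⟨.top⟩

instance [Inhabited A] (k : StackName) : Inhabited (StackSym A k) := by
  cases k
  · exact ‹Inhabited A›
  · exact ⟨(.top, false)⟩
  · exact ⟨(.top, false)⟩
  · exact ⟨.bit false⟩
  · exact ⟨.bit false⟩
  · exact ⟨false⟩
  · exact ⟨false⟩

instance finite_stackSym [Finite A] (k : StackName) : Finite (StackSym A k) := by
  cases k <;> dsimp only [StackSym] <;> infer_instance

/-- The satisfiability machine. -/
noncomputable def satMachine [Inhabited A] [Finite A] (c : BotConvention) (dec : A → Option Sym)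
    (chk : Bool) : Machine A where
  tm := machine (table c dec chk) (.load false) .i .w
  inputAlphabet := Equiv.refl A
  outputAlphabet := Equiv.refl Bool
  finite_alphabet := finite_stackSym (A := A)

theorem satMachine_decides [Inhabited A] [Finite A] {c : BotConvention} {dec : A → Option Sym}
    {chk : Bool} {u : List A} {k : ℕ} {x : List Sym}
    (hu : u.map dec = List.replicate k none ++ x.map some) (h₀ : chk = false → k = 0) {P : Prop}
    (hP : P ↔ (chk = true → x.count Sym.or = k) ∧
      ∃ y, y.map Prod.fst = x ∧ Untagged y ∧ Good c y) :
    (satMachine c dec chk).DecidesInTime u P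
      (totalTime k (if chk then k else x.count Sym.or) x.length) := by
  obtain ⟨res, hres, m, hm, h⟩ := runs_decide (c := c) u k x hu h₀
  obtain ⟨m', hm', h'⟩ := machine_evals (table c dec chk) (length_table_le c dec chk)
    (.load false) .i .w _ m _ _ h
  refine ⟨res, hres.trans hP.symm, ⟨⟨⟨m', ?_⟩, hm'.trans hm⟩⟩⟩
  have e₁ : Turing.initList (satMachine c dec chk).tm
      (u.map (satMachine c dec chk).inputAlphabet.symm) =
        (⟨some (), (.load false, fun _ => none), (Words.mk u [] [] [] [] [] []).get⟩ :
          Turing.TM2.Cfg (StackSym A) Unit (Buffer (StackSym A) Ctrl)) := by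
    refine congrArg (Turing.TM2.Cfg.mk _ _) (funext fun k => ?_)
    cases k
    · exact List.map_id u
    all_goals rfl
  have e₂ : Turing.haltList (satMachine (A := A) c dec chk).tm
      ([res].map (satMachine (A := A) c dec chk).outputAlphabet.symm) =
        (⟨none, (.load false, fun _ => none), (Words.mk [] [] [] [] [] [res] []).get⟩ :
          Turing.TM2.Cfg (StackSym A) Unit (Buffer (StackSym A) Ctrl)) := by
    refine congrArg (Turing.TM2.Cfg.mk _ _) (funext fun k => ?_)
    cases k <;> rfl
  exact (congrArg _ (congrArg some e₁)).trans (h'.trans (congrArg some e₂.symm))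

/-- The rounds contribute `12`, the term `3 * N + 3` contributes `3`, and the tally marks contribute
`2 * k`. -/
theorem totalTime_le (k e N : ℕ) :
    totalTime k e N ≤ (2 * k + 15) * 2 ^ e * (N + 1) ^ 3 := by
  have h₁ : roundTime N ≤ 12 * (N + 1) ^ 3 := by
    unfold roundTime literalTime
    nlinarith [Nat.zero_le N, Nat.zero_le (N ^ 2), Nat.zero_le (N ^ 3)]
  have h₂ : N + 1 ≤ (N + 1) ^ 3 := Nat.le_self_pow (by norm_num) _
  have h₃ := Nat.one_le_two_pow (n := e)
  have h₄ : 2 ^ e * roundTime N ≤ 2 ^ e * (12 * (N + 1) ^ 3) := Nat.mul_le_mul_left _ h₁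
  have h₅ : 1 * (N + 1) ^ 3 ≤ 2 ^ e * (N + 1) ^ 3 := Nat.mul_le_mul_right _ h₃
  have h₆ : k * 1 ≤ k * (2 ^ e * (N + 1) ^ 3) := Nat.mul_le_mul_left _ (by omega)
  have h₇ : (2 * k + 15) * 2 ^ e * (N + 1) ^ 3 =
    2 * (k * (2 ^ e * (N + 1) ^ 3)) + 3 * (2 ^ e * (N + 1) ^ 3) +
      2 ^ e * (12 * (N + 1) ^ 3) := by ring
  rw [h₇, totalTime]
  omega

theorem inFPT_satBySplits (c : BotConvention) : InFPT (satBySplits c) := by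
  refine ⟨satMachine c id true, fun k => (2 * k + 15) * 2 ^ k, (Polynomial.X + 1) ^ 3, ?_, ?_⟩
  · have h : Primrec fun k : ℕ => 2 ^ k := by
      have := Primrec.nat_rec₁ (f := fun _ m : ℕ => 2 * m) 1
        (Primrec.nat_mul.comp (Primrec.const 2) Primrec.snd)
      refine this.of_eq fun k => ?_
      induction k with
      | zero => rfl
      | succ k ih => simp only [ih, pow_succ]; ring
    exact (Primrec.nat_mul.comp (Primrec.nat_add.comp
      (Primrec.nat_mul.comp (Primrec.const 2) Primrec.id) (Primrec.const 15)) h).to_comp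
  · intro x k
    obtain ⟨b, hb, ⟨h⟩⟩ := satMachine_decides (c := c) (dec := id) (chk := true)
      (u := inputWord x k) (k := k) (x := x) (by simp [inputWord]) (by simp)
      (P := (x, k) ∈ satBySplits c) (by
        constructor
        · rintro ⟨Φ, hΦ, hk, hS⟩
          exact ⟨fun _ => hΦ.count_or.trans hk.symm, (exists_good_iff hΦ).2 hS⟩
        · rintro ⟨hk, hG⟩
          -- The input need not be well-formed; a good tagging forces it to represent a formula.
          obtain ⟨y, rfl, -, hy⟩ := id hG
          obtain ⟨Φ, hΦ⟩ := hy.exists_writes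
          exact ⟨Φ, hΦ, (hk rfl).symm.trans hΦ.count_or, (exists_good_iff hΦ).1 hG⟩)
    refine ⟨b, hb, ⟨⟨h.toEvalsTo, h.steps_le_m.trans ?_⟩⟩⟩
    simpa using totalTime_le k k x.length

theorem exists_machine_satisfiable (c : BotConvention) :
    ∃ (M : Machine Sym) (C d : ℕ), ∀ (Φ : Formula) (x : List Sym), Writes x Φ →
      M.DecidesInTime x (Satisfiable c Φ) (C * 2 ^ splits Φ * x.length ^ d) := by
  -- `120 = 15 * 2 ^ 3`: a word for a formula is nonempty, so `x.length + 1 ≤ 2 * x.length`.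
  refine ⟨satMachine c some false, 120, 3, fun Φ x hΦ => ?_⟩
  obtain ⟨b, hb, ⟨h⟩⟩ := satMachine_decides (c := c) (dec := some) (chk := false)
    (u := x) (k := 0) (x := x) (by simp) (by simp) (P := Satisfiable c Φ)
    (by simpa using (exists_good_iff hΦ).symm)
  refine ⟨b, hb, ⟨⟨h.toEvalsTo, h.steps_le_m.trans ?_⟩⟩⟩
  refine (totalTime_le _ _ _).trans ?_
  have h₁ : (x.length + 1) ^ 3 ≤ (2 * x.length) ^ 3 :=
    Nat.pow_le_pow_left (by have := hΦ.length_pos; omega) 3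
  calc _ ≤ 15 * 2 ^ x.count Sym.or * (2 * x.length) ^ 3 := Nat.mul_le_mul_left _ h₁
    _ = _ := by rw [hΦ.count_or]; ring

end Main

end PDL

theorem mainTheorem3 (c : PDL.BotConvention) :
    PDL.InFPT (PDL.satBySplits c) ∧
      ∃ (M : PDL.Machine PDL.Sym) (C d : ℕ), ∀ (Φ : PDL.Formula) (x : List PDL.Sym),
        PDL.Writes x Φ →
          M.DecidesInTime x (PDL.Satisfiable c Φ) (C * 2 ^ PDL.splits Φ * x.length ^ d) :=
  ⟨PDL.inFPT_satBySplits c, PDL.exists_machine_satisfiable c⟩
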